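/- For $\lambda\in\mathbb R$ and a real-valued, integrable, compactly supported function $q$ on $\mathbb R$, consider $$-y''+V y=z^2y,\qquad V(x)=\frac{\lambda}{\cosh^2 x}+q(x),\qquad z\in\mathbb C ,$$ where solutions are continuously differentiable with locally absolutely continuous derivative and satisfy the equation almost everywhere. Put $a=\tfrac12-iz+\sqrt{\tfrac14-\lambda}$, $b=\tfrac12-iz-\sqrt{\tfrac14-\lambda}$, $c=1-iz$, let $\mathbb F(a,b,c;\zeta)=\sum_{n\ge0}\frac{(a)_n(b)_n}{\Gamma(c+n)}\frac{\zeta^n}{n!}$, and set $$\mathbf f_0^{+}(x,z)=(2\cosh x)^{iz}\,\mathbb F\!\left(a,b,c;\tfrac{1}{1+e^{2x}}\right),\qquad \mathbf f_0^{-}(x,z)=\mathbf f_0^{+}(-x,z).$$ The normalised Jost solutions $\mathbf f^{\pm}(\cdot,z)$ are the solutions of the equation that coincide with $\mathbf f_0^{\pm}(\cdot,z)$ near $\pm\infty$. With the Wronskian $[f,g]=fg'-f'g$, put $$W(z)=[\mathbf f^-(\cdot,z),\mathbf f^+(\cdot,z)],\qquad S^\pm(z)=[\mathbf f^+(\cdot,\mp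 z),\mathbf f^-(\cdot,\pm z)],\qquad R^\pm=S^\pm/W$$ (the normalised Jost functions and reflection coefficients). **Proposition.** (i) For every such $\lambda$, $q$ and every $z\in\mathbb C$ the solutions $\mathbf f^\pm(\cdot,z)$ exist and are unique, the Wronskian $W(z)$ does not depend on $x$, and $W$ is an entire function of growth order at most one. For every $z\in\mathbb C\setminus i\mathbb Z$ and every integer $n\ge1$, $z$ is a zero of $W$ of multiplicity $n$ if and only if it is a pole of $R^+$ of order $n$, and if and only if it is a pole of $R^-$ of order $n$. (ii) The function $W$ is fully determined by its zeros: if $W$ and $\widetilde W$ are the normalised Jost functions associated with $(\lambda,q)$ and $(\tilde\lambda,\tilde q)$ as above, and if $W$ and $\widetilde W$ have the same non-zero zeros, with the same multiplicities, then $W=\widetilde W$ on $\mathbb C$. -/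

import Mathlib

open MeasureTheory Filter

noncomputable section

namespace PoschlTeller

/-- The square root of a real number used for the hypergeometric parameters: `√x` for `x ≥ 0`
and `i √(-x)` for `x < 0`. -/
def realSqrt (x : ℝ) : ℂ :=
  if 0 ≤ x then (Real.sqrt x : ℂ) else Complex.I * (Real.sqrt (-x) : ℂ)

/-- `a = 1/2 - i z + √(1/4 - lam)`. -/
def paramA (lam : ℝ) (z : ℂ) : ℂ := 1 / 2 - Complex.I * z + realSqrt (1 / 4 - lam)

/-- `b = 1/2 - i z - √(1/4 - lam)`. -/
def paramB (lam : ℝ) (z : ℂ) : ℂ := 1 / 2 - Complex.I * z - realSqrt (1 / 4 - lam)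

/-- `c = 1 - i z`. -/
def paramC (z : ℂ) : ℂ := 1 - Complex.I * z

/-- The normalised Jost solution at `+∞` of the unperturbed equation,
`(2 cosh x)^(i z) * 𝔽(a, b, c; 1 / (1 + e^(2x)))`, where
`𝔽(a, b, c; ζ) = ∑ (a)_n (b)_n / Γ(c + n) * ζ^n / n!` is the regularized Gauss hypergeometric
function. It is the Jost solution (asymptotic to `e^(i x z)`) divided by `Γ(1 - i z)`. -/
def freeJostPlus (lam : ℝ) (z : ℂ) (x : ℝ) : ℂ :=
  ((2 * Real.cosh x : ℝ) : ℂ) ^ (Complex.I * z) *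
    Complex.regularizedGaussHGFun (paramA lam z) (paramB lam z) (paramC z)
      ((1 / (1 + Real.exp (2 * x)) : ℝ) : ℂ)

/-- The normalised Jost solution at `-∞` of the unperturbed equation,
`(2 cosh x)^(i z) * 𝔽(a, b, c; e^(2x) / (1 + e^(2x)))`. -/
def freeJostMinus (lam : ℝ) (z : ℂ) (x : ℝ) : ℂ :=
  ((2 * Real.cosh x : ℝ) : ℂ) ^ (Complex.I * z) *
    Complex.regularizedGaussHGFun (paramA lam z) (paramB lam z) (paramC z)
      ((Real.exp (2 * x) / (1 + Real.exp (2 * x)) : ℝ) : ℂ)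

/-- The potential `V(x) = lam / cosh² x + q(x)`. -/
def potential (lam : ℝ) (q : ℝ → ℝ) (x : ℝ) : ℝ := lam / Real.cosh x ^ 2 + q x

/-- `y` is a solution of `-y'' + V y = z² y` in the Carathéodory sense: `y` is continuously
differentiable and `y'` is a primitive of `(V - z²) y`. For locally integrable `V` this says that
`y` and `y'` are locally absolutely continuous and that the equation holds almost everywhere. -/
def IsSchrodingerSolution (V : ℝ → ℝ) (z : ℂ) (y : ℝ → ℂ) : Prop :=
  ContDiff ℝ 1 y ∧
    ∀ s t : ℝ, deriv y t - deriv y s = ∫ x in s..t, ((V x : ℂ) - z ^ 2) * y x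

/-- `y` is the normalised Jost solution at `+∞` with spectral parameter `z`: it solves the
perturbed equation and coincides near `+∞` (that is, to the right of the support of `q`)
with the normalised Jost solution of the unperturbed equation. -/
def IsJostPlus (lam : ℝ) (q : ℝ → ℝ) (z : ℂ) (y : ℝ → ℂ) : Prop :=
  IsSchrodingerSolution (potential lam q) z y ∧ ∀ᶠ x in atTop, y x = freeJostPlus lam z x

/-- `y` is the normalised Jost solution at `-∞` with spectral parameter `z`: it solves the
perturbed equation and coincides near `-∞` (that is, to the left of the support of `q`)
with the normalised Jost solution of the unperturbed equation. -/
def IsJostMinus (lam : ℝ) (q : ℝ → ℝ) (z : ℂ) (y : ℝ → ℂ) : Prop :=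
  IsSchrodingerSolution (potential lam q) z y ∧ ∀ᶠ x in atBot, y x = freeJostMinus lam z x

/-- The normalised Jost solution at `+∞`, the function `y` with `IsJostPlus lam q z y`. Its
existence and uniqueness are part of the theorem. -/
def jostPlus (lam : ℝ) (q : ℝ → ℝ) (z : ℂ) : ℝ → ℂ := Classical.epsilon (IsJostPlus lam q z)

/-- The normalised Jost solution at `-∞`, the function `y` with `IsJostMinus lam q z y`. Its
existence and uniqueness are part of the theorem. -/
def jostMinus (lam : ℝ) (q : ℝ → ℝ) (z : ℂ) : ℝ → ℂ := Classical.epsilon (IsJostMinus lam q z)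

/-- The Wronskian `[f, g] = f g' - f' g` at the point `x`. -/
def wronskian (f g : ℝ → ℂ) (x : ℝ) : ℂ := f x * deriv g x - deriv f x * g x

/-- The normalised Jost function `W(z) = [f⁻(·, z), f⁺(·, z)]`. The Wronskian does not depend on
the point of evaluation (this is part of the theorem); it is taken at `0`. -/
def jostW (lam : ℝ) (q : ℝ → ℝ) (z : ℂ) : ℂ :=
  wronskian (jostMinus lam q z) (jostPlus lam q z) 0

/-- The normalised Jost function `S⁺(z) = [f⁺(·, -z), f⁻(·, z)]`. -/
def jostSPlus (lam : ℝ) (q : ℝ → ℝ) (z : ℂ) : ℂ :=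
  wronskian (jostPlus lam q (-z)) (jostMinus lam q z) 0

/-- The normalised Jost function `S⁻(z) = [f⁺(·, z), f⁻(·, -z)]`. -/
def jostSMinus (lam : ℝ) (q : ℝ → ℝ) (z : ℂ) : ℂ :=
  wronskian (jostPlus lam q z) (jostMinus lam q (-z)) 0

/-- The normalised reflection coefficient `R⁺ = S⁺ / W`. -/
def reflectionPlus (lam : ℝ) (q : ℝ → ℝ) (z : ℂ) : ℂ := jostSPlus lam q z / jostW lam q z

/-- The normalised reflection coefficient `R⁻ = S⁻ / W`. -/
def reflectionMinus (lam : ℝ) (q : ℝ → ℝ) (z : ℂ) : ℂ := jostSMinus lam q z / jostW lam q z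

/-- `f` is an entire function whose growth order is at most one. -/
def IsEntireOfOrderAtMostOne (f : ℂ → ℂ) : Prop :=
  Differentiable ℂ f ∧
    ∀ ε : ℝ, 0 < ε → ∃ C : ℝ, ∀ z : ℂ, ‖f z‖ ≤ C * Real.exp (‖z‖ ^ (1 + ε))

end PoschlTeller

end

/-!
The equation `-y'' + V y = z² y` with an integrable perturbation `q` becomes, for the
quasi-derivative `w = y' - Q y` with `Q = ∫₀ q`, a first order linear system whose coefficients are
continuous in `x` and polynomial in `z` (`IsQuasiSolution`). Its solutions with holomorphic initial
values are holomorphic in `z` (`exists_linearODE_solution`), and Grönwall's inequality for the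
vector `((1 + |z|) y, w)` shows that they keep growth of order at most one in `z`
(`growthAtMostOne_isQuasiSolution`). The initial values come from the free Jost solution to the
right of the support of `q`, which solves the free equation by the hypergeometric equation and is of
order at most one because its power series has coefficients bounded by `M! K^M 8^n` with
`M = |z| + O(1)`; the lower bound for `|Γ|` behind this is `Gamma_re_mul_exp_le_norm_Gamma`. The
Jost solution at `-∞` is obtained by reflection, and `W`, a polynomial in the values at `0`, is
entire of order at most one.

Outside `iℤ` the Jost solutions at `z` and `-z` have a non-zero Wronskian, read off at infinity
(`IsJostPlus.wronskian_neg`). At a zero of `W` the Jost solutions at the two ends are proportional,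
so `S⁺` and `S⁻` do not vanish there, and the pole of `S^± / W` has exactly the order of the zero.

For the uniqueness, two such functions `W₁`, `W₂` with the same non-zero zeros have orders `k₁`,
`k₂` at the origin, and `z^{k₂} W₁` and `z^{k₁} W₂` have the same zeros altogether. Their quotient
is `e^g` with `g` entire; Jensen's formula bounds the averages of `(Re g)⁺` over circles by
`O(r^{3/2})`, and Poisson's formula, the Borel–Carathéodory theorem and Cauchy's
estimate make `g` a polynomial of degree at most one
(`IsEntireOfOrderAtMostOne.exists_eq_exp_mul`), the special case of Hadamard's theorem that is
needed. Finally `W(iκ) ~ -2κ / Γ(1 + κ)²` as `κ → ∞`, whatever `lam` and `q` are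
(`tendsto_jostW`), so the quotient `z^m e^{αz + β}` tends to `1` along the imaginary axis, which
forces it to be `1`.
-/


open scoped Topology Interval Nat

namespace PoschlTeller

/-! ### Linear systems depending on a complex parameter -/

section LinearODE

variable {E : Type*} [NormedAddCommGroup E] [NormedSpace ℂ E]

/-- An integral over a compact interval of a jointly continuous function that is holomorphic in a
parameter is holomorphic in the parameter. -/
theorem differentiable_intervalIntegral_of_continuous [CompleteSpace E] {F : ℂ → ℝ → E}
    (hF : Continuous (Function.uncurry F)) (hd : ∀ t, Differentiable ℂ fun z => F z t) (a b : ℝ) :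
    Differentiable ℂ fun z => ∫ t in a..b, F z t := by
  intro z₀
  have hK : IsCompact (Metric.closedBall z₀ 2 ×ˢ Set.uIcc a b) :=
    (isCompact_closedBall z₀ 2).prod isCompact_uIcc
  obtain ⟨M, hM⟩ := hK.exists_bound_of_continuousOn hF.continuousOn
  have hsw : Continuous (Function.uncurry fun t z => F z t) := hF.comp continuous_swap
  refine (intervalIntegral.hasDerivAt_integral_of_dominated_loc_of_deriv_le
    (F' := fun z t => deriv (fun w => F w t) z) (bound := fun _ => M / 1)
    (Metric.ball_mem_nhds z₀ one_pos) (.of_forall fun z => ?_) ?_ ?_ (.of_forall ?_) (by simp)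
    (.of_forall fun t _ z _ => (hd t z).hasDerivAt)).2.differentiableAt
  · exact (hF.comp (Continuous.prodMk_right z)).aestronglyMeasurable
  · exact (hF.comp (Continuous.prodMk_right z₀)).intervalIntegrable _ _
  · have := (stronglyMeasurable_deriv_with_param hsw).comp_measurable
      (measurable_id.prodMk measurable_const : Measurable fun t : ℝ => (t, z₀))
    exact this.aestronglyMeasurable
  · intro t ht z hz
    refine Complex.norm_deriv_le_of_forall_mem_sphere_norm_le one_pos (hd t).diffContOnCl
      fun w hw => hM (w, t) ⟨?_, Set.uIoc_subset_uIcc ht⟩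
    have h1 := Metric.mem_ball.1 hz
    have h2 := Metric.mem_sphere.1 hw
    exact Metric.mem_closedBall.2 ((dist_triangle w z z₀).trans (by linarith))

/-- The Picard iterates (the terms of the Neumann series) of the linear system `Y' = A Y` with
initial value `v` at `x₀`, depending on a complex parameter. -/
noncomputable def neumannTerm (A : ℝ → ℂ → E →L[ℂ] E) (v : ℂ → E) (x₀ : ℝ) : ℕ → ℂ → ℝ → E
  | 0 => fun z _ => v z
  | n + 1 => fun z x => ∫ t in x₀..x, A t z (neumannTerm A v x₀ n z t)

variable {A : ℝ → ℂ → E →L[ℂ] E} {v : ℂ → E} {x₀ : ℝ}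

theorem continuous_uncurry_neumannTerm (hA : Continuous (Function.uncurry A))
    (hv : Differentiable ℂ v) (n : ℕ) :
    Continuous (Function.uncurry (neumannTerm A v x₀ n)) := by
  induction n with
  | zero => exact hv.continuous.comp continuous_fst
  | succ n ih =>
    have h : Continuous (Function.uncurry fun z t => A t z (neumannTerm A v x₀ n z t)) :=
      (hA.comp continuous_swap).clm_apply ih
    exact intervalIntegral.continuous_parametric_intervalIntegral_of_continuous
      (X := ℂ × ℝ) (f := fun p t => A t p.1 (neumannTerm A v x₀ n p.1 t))
      (h.comp ((continuous_fst.comp continuous_fst).prodMk continuous_snd)) continuous_snd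

theorem differentiable_neumannTerm [CompleteSpace E] (hA : Continuous (Function.uncurry A))
    (hAd : ∀ t, Differentiable ℂ (A t)) (hv : Differentiable ℂ v) (n : ℕ) (x : ℝ) :
    Differentiable ℂ fun z => neumannTerm A v x₀ n z x := by
  induction n generalizing x with
  | zero => exact hv
  | succ n ih =>
    exact differentiable_intervalIntegral_of_continuous
      (F := fun z t => A t z (neumannTerm A v x₀ n z t))
      ((hA.comp continuous_swap).clm_apply (continuous_uncurry_neumannTerm hA hv n))
      (fun t => (hAd t).clm_apply (ih t)) x₀ x

theorem hasDerivAt_neumannTerm_succ [CompleteSpace E] (hA : Continuous (Function.uncurry A))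
    (hv : Differentiable ℂ v) (n : ℕ) (z : ℂ) (x : ℝ) :
    HasDerivAt (neumannTerm A v x₀ (n + 1) z) (A x z (neumannTerm A v x₀ n z x)) x := by
  have h : Continuous fun t => A t z (neumannTerm A v x₀ n z t) :=
    (hA.comp (Continuous.prodMk_left z)).clm_apply
      ((continuous_uncurry_neumannTerm hA hv n).comp (Continuous.prodMk_right z))
  exact intervalIntegral.integral_hasDerivAt_right (h.intervalIntegrable _ _)
    (h.stronglyMeasurableAtFilter _ _) h.continuousAt

/-- The terms of the Neumann series are dominated by those of an exponential series, locally
uniformly in the parameter. -/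
theorem norm_neumannTerm_le {K M R : ℝ} {z : ℂ} (hK : ∀ t, |t - x₀| ≤ R → ‖A t z‖ ≤ K)
    (hM : ‖v z‖ ≤ M) (n : ℕ) {x : ℝ} (hx : |x - x₀| ≤ R) :
    ‖neumannTerm A v x₀ n z x‖ ≤ M * (K * |x - x₀|) ^ n / n.factorial := by
  have hK0 : 0 ≤ K := (norm_nonneg _).trans (hK x hx)
  induction n generalizing x with
  | zero => simpa [neumannTerm] using hM
  | succ n ih =>
    have hle : ∀ t ∈ Ι x₀ x, |t - x₀| ≤ |x - x₀| := fun t ht =>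
      Set.abs_sub_left_of_mem_uIcc (Set.uIoc_subset_uIcc ht)
    have hb : ∀ t ∈ Ι x₀ x, ‖A t z (neumannTerm A v x₀ n z t)‖ ≤
        K * (M * K ^ n / n.factorial) * |t - x₀| ^ n := by
      intro t ht
      have htR := (hle t ht).trans hx
      calc ‖A t z (neumannTerm A v x₀ n z t)‖ ≤ ‖A t z‖ * ‖neumannTerm A v x₀ n z t‖ :=
            (A t z).le_opNorm _
        _ ≤ K * (M * (K * |t - x₀|) ^ n / n.factorial) :=
            mul_le_mul (hK t htR) (ih htR) (norm_nonneg _) hK0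
        _ = _ := by rw [mul_pow]; ring
    have hint : IntegrableOn (fun t => K * (M * K ^ n / n.factorial) * |t - x₀| ^ n) (Ι x₀ x) :=
      intervalIntegrable_iff.1 ((by fun_prop : Continuous fun t : ℝ =>
        K * (M * K ^ n / n.factorial) * |t - x₀| ^ n).intervalIntegrable _ _)
    calc ‖neumannTerm A v x₀ (n + 1) z x‖
        ≤ ∫ t in Ι x₀ x, ‖A t z (neumannTerm A v x₀ n z t)‖ :=
          intervalIntegral.norm_integral_le_integral_norm_uIoc
      _ ≤ ∫ t in Ι x₀ x, K * (M * K ^ n / n.factorial) * |t - x₀| ^ n := by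
          refine integral_mono_of_nonneg (.of_forall fun _ => norm_nonneg _) hint ?_
          filter_upwards [ae_restrict_mem measurableSet_uIoc] with t ht using hb t ht
      _ = M * (K * |x - x₀|) ^ (n + 1) / (n + 1).factorial := by
          rw [integral_const_mul, integral_pow_abs_sub_uIoc, Nat.factorial_succ, mul_pow]
          push_cast
          field_simp
          ring

/-- A linear system `Y' = A Y` whose coefficients are continuous in the time and holomorphic in a
complex parameter has, for holomorphic initial data, a global solution that is holomorphic in the
parameter. -/
theorem exists_linearODE_solution [CompleteSpace E] (hA : Continuous (Function.uncurry A))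
    (hAd : ∀ t, Differentiable ℂ (A t)) (hv : Differentiable ℂ v) (x₀ : ℝ) :
    ∃ Y : ℂ → ℝ → E, (∀ z, Y z x₀ = v z) ∧
      (∀ z x, HasDerivAt (Y z) (A x z (Y z x)) x) ∧ ∀ x, Differentiable ℂ fun z => Y z x := by
  have bounds : ∀ (R : ℝ) (z₀ : ℂ), ∃ K M : ℝ, 0 ≤ K ∧ 0 ≤ M ∧
      ∀ z ∈ Metric.ball z₀ 1, (∀ t, |t - x₀| ≤ R → ‖A t z‖ ≤ K) ∧ ‖v z‖ ≤ M := by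
    intro R z₀
    obtain ⟨K, hK⟩ := ((isCompact_closedBall x₀ R).prod
      (isCompact_closedBall z₀ 1)).exists_bound_of_continuousOn hA.continuousOn
    obtain ⟨M, hM⟩ := (isCompact_closedBall z₀ 1).exists_bound_of_continuousOn
      hv.continuous.continuousOn
    exact ⟨max K 0, max M 0, le_max_right _ _, le_max_right _ _, fun z hz =>
      ⟨fun t ht => (hK (t, z) ⟨by simpa [Real.dist_eq] using ht,
        Metric.ball_subset_closedBall hz⟩).trans (le_max_left _ _),
      (hM z (Metric.ball_subset_closedBall hz)).trans (le_max_left _ _)⟩⟩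
  have hsum : ∀ (K M R : ℝ), Summable fun n : ℕ => M * (K * R) ^ n / n.factorial := by
    intro K M R
    simpa [mul_div_assoc] using (Real.summable_pow_div_factorial (K * R)).mul_left M
  have hbd : ∀ (R : ℝ) (z₀ : ℂ), ∃ K M : ℝ, 0 ≤ K ∧ 0 ≤ M ∧
      ∀ z ∈ Metric.ball z₀ 1, ∀ x, |x - x₀| ≤ R →
        ‖A x z‖ ≤ K ∧ ∀ n, ‖neumannTerm A v x₀ n z x‖ ≤ M * (K * R) ^ n / n.factorial := by
    intro R z₀
    obtain ⟨K, M, hK0, hM0, h⟩ := bounds R z₀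
    refine ⟨K, M, hK0, hM0, fun z hz x hx => ⟨(h z hz).1 x hx, fun n => ?_⟩⟩
    refine (norm_neumannTerm_le (h z hz).1 (h z hz).2 n hx).trans ?_
    gcongr
  refine ⟨fun z x => ∑' n, neumannTerm A v x₀ n z x, fun z => ?_, fun z x => ?_, fun x z₀ => ?_⟩
  · beta_reduce
    rw [tsum_eq_single 0]
    · rfl
    · intro n hn
      obtain ⟨m, rfl⟩ := Nat.exists_eq_succ_of_ne_zero hn
      simp [neumannTerm]
  · obtain ⟨K, M, hK0, hM0, h⟩ := hbd (|x - x₀| + 1) z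
    have hz := h z (Metric.mem_ball_self one_pos)
    have hS : ∀ y, |y - x₀| ≤ |x - x₀| + 1 → Summable fun n => neumannTerm A v x₀ n z y :=
      fun y hy => .of_norm_bounded (hsum K M _) (hz y hy).2
    have hx1 : |x - x₀| ≤ |x - x₀| + 1 := by linarith
    have hmem : ∀ y, y ∈ Metric.ball x₀ (|x - x₀| + 1) → |y - x₀| ≤ |x - x₀| + 1 := by
      intro y hy
      exact (by simpa [Real.dist_eq] using hy : |y - x₀| < |x - x₀| + 1).le
    have key := hasDerivAt_tsum_of_isPreconnected (𝕜 := ℝ)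
      (g := fun n => neumannTerm A v x₀ (n + 1) z)
      (g' := fun n y => A y z (neumannTerm A v x₀ n z y))
      (u := fun n => K * (M * (K * (|x - x₀| + 1)) ^ n / n.factorial))
      ((hsum K M _).mul_left K) (t := Metric.ball x₀ (|x - x₀| + 1)) Metric.isOpen_ball
      (convex_ball _ _).isPreconnected
      (fun n y _ => hasDerivAt_neumannTerm_succ hA hv n z y)
      (fun n y hy => ((A y z).le_opNorm _).trans
        (mul_le_mul (hz y (hmem y hy)).1 ((hz y (hmem y hy)).2 n) (norm_nonneg _) hK0))
      (y₀ := x) (y := x) (by simp [Real.dist_eq]) ((summable_nat_add_iff 1).2 (hS x hx1))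
      (by simp [Real.dist_eq])
    rw [← (A x z).map_tsum (hS x hx1)] at key
    have key2 := key.const_add (v z)
    refine key2.congr_of_eventuallyEq ?_
    filter_upwards [Metric.isOpen_ball.mem_nhds
      (by simp [Real.dist_eq] : x ∈ Metric.ball x₀ (|x - x₀| + 1))] with y hy
    rw [(hS y (hmem y hy)).tsum_eq_zero_add]
    rfl
  · obtain ⟨K, M, hK0, hM0, h⟩ := hbd |x - x₀| z₀
    exact (Complex.differentiableOn_tsum_of_summable_norm (hsum K M |x - x₀|)
      (fun n => (differentiable_neumannTerm hA hAd hv n x).differentiableOn)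
      Metric.isOpen_ball (fun n z hz => (h z hz x le_rfl).2 n)).differentiableAt
      (Metric.ball_mem_nhds z₀ one_pos)

end LinearODE

/-- Grönwall's inequality for a function with `‖f'‖ ≤ K ‖f‖`, in both time directions. -/
theorem norm_le_mul_exp_of_norm_deriv_le {E : Type*} [NormedAddCommGroup E] [NormedSpace ℝ E]
    {f f' : ℝ → E} {K a x : ℝ} (hf : ∀ t ∈ [[a, x]], HasDerivAt f (f' t) t)
    (hb : ∀ t ∈ [[a, x]], ‖f' t‖ ≤ K * ‖f t‖) :
    ‖f x‖ ≤ ‖f a‖ * Real.exp (K * |x - a|) := by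
  rcases le_total a x with h | h
  · rw [Set.uIcc_of_le h] at hf hb
    have := norm_le_gronwallBound_of_norm_deriv_right_le (f := f) (f' := f') (δ := ‖f a‖) (K := K)
      (ε := 0) (a := a) (b := x) (fun t ht => (hf t ht).continuousAt.continuousWithinAt)
      (fun t ht => (hf t (Set.Ico_subset_Icc_self ht)).hasDerivWithinAt) le_rfl
      (fun t ht => by simpa using hb t (Set.Ico_subset_Icc_self ht))
      x (Set.right_mem_Icc.2 h)
    rwa [gronwallBound_ε0, ← abs_of_nonneg (sub_nonneg.2 h)] at this
  · rw [Set.uIcc_of_ge h] at hf hb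
    have hmem : ∀ t ∈ Set.Icc (-a) (-x), -t ∈ Set.Icc x a := fun t ht =>
      ⟨by linarith [ht.2], by linarith [ht.1]⟩
    have hg : ∀ t ∈ Set.Icc (-a) (-x), HasDerivAt (fun s => f (-s)) (-f' (-t)) t := by
      intro t ht
      simpa [Function.comp_def] using (hf (-t) (hmem t ht)).scomp t (hasDerivAt_neg t)
    have := norm_le_gronwallBound_of_norm_deriv_right_le (f := fun s => f (-s))
      (f' := fun s => -f' (-s)) (δ := ‖f a‖) (K := K)
      (ε := 0) (a := -a) (b := -x) (fun t ht => (hg t ht).continuousAt.continuousWithinAt)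
      (fun t ht => (hg t (Set.Ico_subset_Icc_self ht)).hasDerivWithinAt) (by simp)
      (fun t ht => by simpa using hb (-t) (hmem t (Set.Ico_subset_Icc_self ht)))
      (-x) (Set.right_mem_Icc.2 (by linarith))
    rw [gronwallBound_ε0, neg_neg] at this
    rwa [abs_of_nonpos (sub_nonpos.2 h), show -(x - a) = -x - -a by ring]

/-! ### Quasi-derivatives: the Schrödinger equation as a continuous linear system -/

section

/-- The primitive `Q(x) = ∫₀ˣ q` of the perturbation, as a complex-valued function. -/
noncomputable def primitiveAt (q : ℝ → ℝ) (x : ℝ) : ℂ := ((∫ t in (0 : ℝ)..x, q t : ℝ) : ℂ)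

variable {q : ℝ → ℝ} {lam : ℝ}

theorem continuous_primitiveAt (hq : Integrable q) : Continuous (primitiveAt q) :=
  Complex.continuous_ofReal.comp
    (intervalIntegral.continuous_primitive (fun _ _ => hq.intervalIntegrable) 0)

theorem integral_mul_add_primitive_mul (hq : Integrable q) {g g' : ℝ → ℝ}
    (hg : ∀ x, HasDerivAt g (g' x) x) (hg' : Continuous g') (s t : ℝ) :
    ∫ x in s..t, (q x * g x + (∫ u in (0 : ℝ)..x, q u) * g' x) =
      (∫ u in (0 : ℝ)..t, q u) * g t - (∫ u in (0 : ℝ)..s, q u) * g s := by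
  have hgC : ContDiff ℝ 1 g := by
    rw [contDiff_one_iff_deriv]
    exact ⟨fun x => (hg x).differentiableAt, by rwa [funext fun x => (hg x).deriv]⟩
  have hac1 : AbsolutelyContinuousOnInterval (fun x => ∫ u in (0 : ℝ)..x, q u) s t := by
    have h := (hq.intervalIntegrable (a := min 0 (min s t))
      (b := max 0 (max s t))).absolutelyContinuousOnInterval_intervalIntegral (c := 0)
      (Set.mem_uIcc_of_le (by simp) (by simp))
    refine h.mono (Set.uIcc_subset_uIcc ?_ ?_) <;> exact Set.mem_uIcc_of_le (by simp) (by simp)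
  have hac2 : AbsolutelyContinuousOnInterval g s t :=
    (hgC.contDiffOn).absolutelyContinuousOnInterval
  rw [← AbsolutelyContinuousOnInterval.integral_deriv_mul_eq_sub hac1 hac2]
  refine intervalIntegral.integral_congr_ae ?_
  filter_upwards [LocallyIntegrable.ae_hasDerivAt_integral hq.locallyIntegrable] with x hx _
  rw [(hx 0).deriv, (hg x).deriv]

/-- Integration by parts for the product of the absolutely continuous function `Q = ∫₀ q` with a
continuously differentiable function. -/
theorem integral_mul_add_primitiveAt_mul (hq : Integrable q) {y y' : ℝ → ℂ}
    (hy : ∀ x, HasDerivAt y (y' x) x) (hy' : Continuous y') (s t : ℝ) :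
    ∫ x in s..t, ((q x : ℂ) * y x + primitiveAt q x * y' x) =
      primitiveAt q t * y t - primitiveAt q s * y s := by
  have hyc : Continuous y := continuous_iff_continuousAt.2 fun x => (hy x).continuousAt
  have hi : IntervalIntegrable (fun x => (q x : ℂ) * y x + primitiveAt q x * y' x) volume s t :=
    (hq.ofReal.intervalIntegrable.mul_continuousOn hyc.continuousOn).add
      (((continuous_primitiveAt hq).mul hy').intervalIntegrable _ _)
  have hre := integral_mul_add_primitive_mul hq (g := fun x => (y x).re) (g' := fun x => (y' x).re)
    (fun x => Complex.reCLM.hasFDerivAt.comp_hasDerivAt x (hy x))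
    (Complex.continuous_re.comp hy') s t
  have him := integral_mul_add_primitive_mul hq (g := fun x => (y x).im) (g' := fun x => (y' x).im)
    (fun x => Complex.imCLM.hasFDerivAt.comp_hasDerivAt x (hy x))
    (Complex.continuous_im.comp hy') s t
  apply Complex.ext
  · have := Complex.reCLM.intervalIntegral_comp_comm hi
    simp only [Complex.reCLM_apply] at this
    rw [← this]
    simpa [primitiveAt] using hre
  · have := Complex.imCLM.intervalIntegral_comp_comm hi
    simp only [Complex.imCLM_apply] at this
    rw [← this]
    simpa [primitiveAt] using him

theorem intervalIntegrable_potential_mul (hq : Integrable q) {y : ℝ → ℂ} (hy : Continuous y)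
    (s t : ℝ) : IntervalIntegrable (fun x => (potential lam q x : ℂ) * y x) volume s t := by
  refine IntervalIntegrable.mul_continuousOn ?_ hy.continuousOn
  have h1 : Continuous fun x => lam / Real.cosh x ^ 2 :=
    continuous_const.div (by fun_prop) fun x => by positivity
  have h2 : IntervalIntegrable (potential lam q) volume s t :=
    (h1.intervalIntegrable _ _).add hq.intervalIntegrable
  exact ⟨h2.1.ofReal, h2.2.ofReal⟩

/-- The coefficient `lam / cosh² x - z² - Q²` of `y` in the equation for the quasi-derivative
`w = y' - Q y`, where `Q = ∫₀ q`. -/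
noncomputable def quasiCoeff (lam : ℝ) (q : ℝ → ℝ) (z : ℂ) (x : ℝ) : ℂ :=
  ((lam / Real.cosh x ^ 2 : ℝ) : ℂ) - z ^ 2 - primitiveAt q x ^ 2

theorem continuous_uncurry_quasiCoeff (hq : Integrable q) :
    Continuous fun p : ℝ × ℂ => quasiCoeff lam q p.2 p.1 := by
  have h1 : Continuous fun x => lam / Real.cosh x ^ 2 :=
    continuous_const.div (by fun_prop) fun x => by positivity
  have h2 := continuous_primitiveAt hq
  exact ((Complex.continuous_ofReal.comp (h1.comp continuous_fst)).sub
    (continuous_snd.pow 2)).sub ((h2.comp continuous_fst).pow 2)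

/-- With the quasi-derivative `w = y' - Q y`, where `Q = ∫₀ q`, the Schrödinger equation with an
integrable potential becomes a first order system with continuous coefficients. -/
def IsQuasiSolution (lam : ℝ) (q : ℝ → ℝ) (z : ℂ) (y w : ℝ → ℂ) : Prop :=
  ∀ x, HasDerivAt y (primitiveAt q x * y x + w x) x ∧
    HasDerivAt w (quasiCoeff lam q z x * y x - primitiveAt q x * w x) x

theorem IsQuasiSolution.isSchrodingerSolution (hq : Integrable q) {z : ℂ} {y w : ℝ → ℂ}
    (h : IsQuasiSolution lam q z y w) : IsSchrodingerSolution (potential lam q) z y := by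
  have hyc : Continuous y := continuous_iff_continuousAt.2 fun x => (h x).1.continuousAt
  have hwc : Continuous w := continuous_iff_continuousAt.2 fun x => (h x).2.continuousAt
  have hQ := continuous_primitiveAt hq
  have hd : deriv y = fun x => primitiveAt q x * y x + w x := funext fun x => (h x).1.deriv
  have hdc : Continuous fun x => primitiveAt q x * y x + w x := (hQ.mul hyc).add hwc
  refine ⟨contDiff_one_iff_deriv.2 ⟨fun x => (h x).1.differentiableAt, hd ▸ hdc⟩, fun s t => ?_⟩
  have hcc : Continuous fun x => quasiCoeff lam q z x * y x - primitiveAt q x * w x :=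
    (((continuous_uncurry_quasiCoeff hq).comp (Continuous.prodMk_left z)).mul hyc).sub (hQ.mul hwc)
  have hw := intervalIntegral.integral_eq_sub_of_hasDerivAt (a := s) (b := t)
    (fun x _ => (h x).2) (hcc.intervalIntegrable _ _)
  have hQy := integral_mul_add_primitiveAt_mul hq (fun x => (h x).1) hdc s t
  have hi : IntervalIntegrable (fun x => (q x : ℂ) * y x +
      primitiveAt q x * (primitiveAt q x * y x + w x)) volume s t :=
    (hq.ofReal.intervalIntegrable.mul_continuousOn hyc.continuousOn).add
      ((hQ.mul hdc).intervalIntegrable _ _)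
  have : deriv y t - deriv y s = (primitiveAt q t * y t - primitiveAt q s * y s) + (w t - w s) := by
    rw [hd]; ring
  rw [this, ← hw, ← hQy, ← intervalIntegral.integral_add hi (hcc.intervalIntegrable _ _)]
  refine intervalIntegral.integral_congr fun x _ => ?_
  simp only [quasiCoeff, potential]
  push_cast
  ring

theorem IsSchrodingerSolution.isQuasiSolution (hq : Integrable q) {z : ℂ} {y : ℝ → ℂ}
    (h : IsSchrodingerSolution (potential lam q) z y) :
    IsQuasiSolution lam q z y fun x => deriv y x - primitiveAt q x * y x := by
  obtain ⟨hC, hint⟩ := h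
  have hy : ∀ x, HasDerivAt y (deriv y x) x := fun x =>
    (hC.differentiable one_ne_zero x).hasDerivAt
  have hyc := hC.continuous
  have hdc : Continuous (deriv y) := hC.continuous_deriv le_rfl
  have hQ := continuous_primitiveAt hq
  have hcc : Continuous fun x => (((lam / Real.cosh x ^ 2 : ℝ) : ℂ) - z ^ 2) * y x
      - primitiveAt q x * deriv y x := by
    have h1 : Continuous fun x => lam / Real.cosh x ^ 2 :=
      continuous_const.div (by fun_prop) fun x => by positivity
    fun_prop
  -- `y' - Q y` is a primitive of a continuous function, since the terms with `q` cancel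
  have key : ∀ t, deriv y t - primitiveAt q t * y t = (deriv y 0 - primitiveAt q 0 * y 0) +
      ∫ x in (0 : ℝ)..t, ((((lam / Real.cosh x ^ 2 : ℝ) : ℂ) - z ^ 2) * y x
      - primitiveAt q x * deriv y x) := by
    intro t
    have hi : IntervalIntegrable (fun x => (q x : ℂ) * y x + primitiveAt q x * deriv y x)
        volume 0 t :=
      (hq.ofReal.intervalIntegrable.mul_continuousOn hyc.continuousOn).add
        ((hQ.mul hdc).intervalIntegrable _ _)
    have h1 : deriv y t - primitiveAt q t * y t - (deriv y 0 - primitiveAt q 0 * y 0) =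
        (deriv y t - deriv y 0) - (primitiveAt q t * y t - primitiveAt q 0 * y 0) := by ring
    rw [← sub_eq_iff_eq_add', h1, hint 0 t, ← integral_mul_add_primitiveAt_mul hq hy hdc 0 t,
      ← intervalIntegral.integral_sub ?_ hi]
    · refine intervalIntegral.integral_congr fun x _ => ?_
      simp only [potential]
      push_cast
      ring
    · simpa only [sub_mul] using (intervalIntegrable_potential_mul hq hyc 0 t).sub
        ((continuous_const.mul hyc).intervalIntegrable (μ := volume)
          (u := fun x => z ^ 2 * y x) 0 t)
  intro x
  refine ⟨by simpa using hy x, ?_⟩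
  have hd := (intervalIntegral.integral_hasDerivAt_right (hcc.intervalIntegrable 0 x)
    (hcc.stronglyMeasurableAtFilter _ _) hcc.continuousAt).const_add
    (deriv y 0 - primitiveAt q 0 * y 0)
  rw [funext key]
  refine hd.congr_deriv ?_
  beta_reduce
  rw [← key x]
  simp only [quasiCoeff]
  ring

/-- The matrix of the first order system satisfied by a solution and its quasi-derivative. -/
noncomputable def quasiMatrix (lam : ℝ) (q : ℝ → ℝ) (x : ℝ) (z : ℂ) : ℂ × ℂ →L[ℂ] ℂ × ℂ :=
  primitiveAt q x • (ContinuousLinearMap.fst ℂ ℂ ℂ).prod (-ContinuousLinearMap.snd ℂ ℂ ℂ) +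
    (ContinuousLinearMap.snd ℂ ℂ ℂ).prod 0 +
    quasiCoeff lam q z x •
      (0 : ℂ × ℂ →L[ℂ] ℂ).prod (ContinuousLinearMap.fst ℂ ℂ ℂ)

theorem quasiMatrix_apply (x : ℝ) (z : ℂ) (v : ℂ × ℂ) : quasiMatrix lam q x z v =
    (primitiveAt q x * v.1 + v.2, quasiCoeff lam q z x * v.1 - primitiveAt q x * v.2) := by
  simp [quasiMatrix]
  ring

theorem continuous_uncurry_quasiMatrix (hq : Integrable q) :
    Continuous (Function.uncurry (quasiMatrix lam q)) := by
  have h1 := continuous_uncurry_quasiCoeff (lam := lam) hq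
  have h2 := (continuous_primitiveAt hq).comp (continuous_fst (X := ℝ) (Y := ℂ))
  exact ((h2.smul continuous_const).add continuous_const).add (h1.smul continuous_const)

theorem differentiable_quasiMatrix (x : ℝ) : Differentiable ℂ (quasiMatrix lam q x) := by
  have h1 : Differentiable ℂ fun z => quasiCoeff lam q z x := by
    unfold quasiCoeff; fun_prop
  exact (differentiable_const _).add (h1.smul_const _)

theorem isQuasiSolution_iff {z : ℂ} {y w : ℝ → ℂ} : IsQuasiSolution lam q z y w ↔
    ∀ x, HasDerivAt (fun x => (y x, w x)) (quasiMatrix lam q x z (y x, w x)) x := by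
  refine forall_congr' fun x => ?_
  rw [quasiMatrix_apply]
  constructor
  · exact fun h => h.1.prodMk h.2
  · intro h
    exact ⟨(ContinuousLinearMap.fst ℝ ℂ ℂ).hasFDerivAt.comp_hasDerivAt x h,
      (ContinuousLinearMap.snd ℝ ℂ ℂ).hasFDerivAt.comp_hasDerivAt x h⟩

/-- Solutions of the first order system with holomorphic initial values are holomorphic in the
spectral parameter. -/
theorem exists_isQuasiSolution (hq : Integrable q) {v₁ v₂ : ℂ → ℂ} (h₁ : Differentiable ℂ v₁)
    (h₂ : Differentiable ℂ v₂) (x₀ : ℝ) : ∃ y w : ℂ → ℝ → ℂ,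
      (∀ z, y z x₀ = v₁ z) ∧ (∀ z, w z x₀ = v₂ z) ∧ (∀ z, IsQuasiSolution lam q z (y z) (w z)) ∧
      (∀ x, Differentiable ℂ fun z => y z x) ∧ ∀ x, Differentiable ℂ fun z => w z x := by
  obtain ⟨Y, h0, hY, hd⟩ := exists_linearODE_solution (continuous_uncurry_quasiMatrix hq)
    (differentiable_quasiMatrix (lam := lam)) (h₁.prodMk h₂) x₀
  exact ⟨fun z x => (Y z x).1, fun z x => (Y z x).2, fun z => congrArg Prod.fst (h0 z),
    fun z => congrArg Prod.snd (h0 z),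
    fun z => isQuasiSolution_iff.2 (hY z), fun x => (hd x).fst, fun x => (hd x).snd⟩

/-- Uniqueness for the first order system, needed only on the interval between the two points. -/
theorem eq_of_hasDerivAt_quasiMatrix (hq : Integrable q) {z : ℂ} {u u₂ : ℝ → ℂ × ℂ} {x₀ x : ℝ}
    (h : ∀ t ∈ [[x₀, x]], HasDerivAt u (quasiMatrix lam q t z (u t)) t)
    (h₂ : ∀ t ∈ [[x₀, x]], HasDerivAt u₂ (quasiMatrix lam q t z (u₂ t)) t)
    (h0 : u x₀ = u₂ x₀) : u x = u₂ x := by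
  obtain ⟨K, hK⟩ := (isCompact_uIcc (a := x₀) (b := x)).exists_bound_of_continuousOn
    ((continuous_uncurry_quasiMatrix (lam := lam) hq).comp
      (Continuous.prodMk_left z)).continuousOn
  have := norm_le_mul_exp_of_norm_deriv_le (K := K) (fun t ht => (h t ht).sub (h₂ t ht))
    (fun t ht => by
      rw [← map_sub]
      exact ((quasiMatrix lam q t z).le_opNorm _).trans
        (mul_le_mul_of_nonneg_right (hK t ht) (norm_nonneg _)))
  simp only [Pi.sub_apply, h0, sub_self, norm_zero, zero_mul] at this
  exact sub_eq_zero.1 (norm_le_zero_iff.1 this)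

theorem IsQuasiSolution.eq_of_eq_at (hq : Integrable q) {z : ℂ} {y w y₂ w₂ : ℝ → ℂ}
    (h : IsQuasiSolution lam q z y w) (h₂ : IsQuasiSolution lam q z y₂ w₂) {x₀ : ℝ}
    (hy : y x₀ = y₂ x₀) (hw : w x₀ = w₂ x₀) : y = y₂ := by
  rw [isQuasiSolution_iff] at h h₂
  funext x
  exact congrArg Prod.fst (eq_of_hasDerivAt_quasiMatrix hq (fun t _ => h t) (fun t _ => h₂ t)
    (Prod.ext hy hw))

theorem IsSchrodingerSolution.eq_of_eq_at (hq : Integrable q) {z : ℂ} {y y₂ : ℝ → ℂ}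
    (h : IsSchrodingerSolution (potential lam q) z y)
    (h₂ : IsSchrodingerSolution (potential lam q) z y₂) {x₀ : ℝ}
    (hy : y x₀ = y₂ x₀) (hw : deriv y x₀ = deriv y₂ x₀) : y = y₂ :=
  (h.isQuasiSolution hq).eq_of_eq_at hq (h₂.isQuasiSolution hq) hy (by simp only [hy, hw])

/-- The Wronskian of two solutions with the same spectral parameter squared is constant. -/
theorem wronskian_eq_wronskian (hq : Integrable q) {z z₂ : ℂ} (hz : z ^ 2 = z₂ ^ 2)
    {y y₂ : ℝ → ℂ} (h : IsSchrodingerSolution (potential lam q) z y)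
    (h₂ : IsSchrodingerSolution (potential lam q) z₂ y₂) (s t : ℝ) :
    wronskian y y₂ s = wronskian y y₂ t := by
  have h' := h.isQuasiSolution hq
  have h₂' := h₂.isQuasiSolution hq
  -- the terms with the primitive of `q` cancel in the Wronskian
  have hW : wronskian y y₂ = fun x => y x * (deriv y₂ x - primitiveAt q x * y₂ x) -
      (deriv y x - primitiveAt q x * y x) * y₂ x := by
    funext x; simp only [wronskian]; ring
  have hd : ∀ x, HasDerivAt (wronskian y y₂) 0 x := by
    intro x
    rw [hW]
    refine (((h' x).1.mul (h₂' x).2).sub ((h' x).2.mul (h₂' x).1)).congr_deriv ?_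
    simp only [quasiCoeff, hz]
    ring
  exact is_const_of_deriv_eq_zero (fun x => (hd x).differentiableAt) (fun x => (hd x).deriv) s t

end

/-! ### Vertical decay of the Gamma function -/

section Gamma

/-- Vertical decay of the Gamma function: `|Γ(σ + iτ)| ≥ Γ(σ) e^{-π|τ|/2}` for `σ ≥ 1/2`. The
quotient `|Γ(σ + iτ)| / Γ(σ)` increases with `σ` by Euler's limit formula, and at `σ = 1/2` it is
known from the reflection formula. -/
theorem Gamma_re_mul_exp_le_norm_Gamma {w : ℂ} (hw : 1 / 2 ≤ w.re) :
    Real.Gamma w.re * Real.exp (-(Real.pi * |w.im| / 2)) ≤ ‖Complex.Gamma w‖ := by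
  set σ := w.re with hσ
  set τ := w.im with hτ
  set h : ℂ := 1 / 2 + τ * Complex.I with hh
  have hhre : h.re = 1 / 2 := by simp [hh]
  have hhim : h.im = τ := by simp [hh]
  have hσ0 : 0 < σ := by linarith
  -- the comparison of the factors in Euler's product for `Γ`, with `h = 1/2 + iτ`
  have hfac : ∀ j : ℕ, (σ + j) * ‖h + j‖ ≥ (1 / 2 + j) * ‖w + j‖ := by
    intro j
    have hj : (0 : ℝ) ≤ j := j.cast_nonneg
    refine abs_le_of_sq_le_sq' ?_ (by positivity) |>.2
    rw [mul_pow, mul_pow, Complex.sq_norm, Complex.sq_norm, Complex.normSq_apply,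
      Complex.normSq_apply]
    simp only [Complex.add_re, Complex.add_im, Complex.natCast_re, Complex.natCast_im, hhre, hhim,
      ← hσ, ← hτ, add_zero]
    nlinarith [mul_nonneg (sq_nonneg τ) (mul_nonneg (sub_nonneg.2 hw)
      (by positivity : 0 ≤ σ + j + (1 / 2 + j)))]
  have hseq : ∀ n : ℕ, 0 < n → ‖Complex.GammaSeq h n‖ * Real.GammaSeq σ n ≤
      ‖Complex.GammaSeq w n‖ * Real.GammaSeq (1 / 2) n := by
    intro n hn
    have hn' : (0 : ℝ) < n := Nat.cast_pos.2 hn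
    have hprod : (∏ j ∈ Finset.range (n + 1), (1 / 2 + j : ℝ)) *
        ‖∏ j ∈ Finset.range (n + 1), (w + j)‖ ≤
        (∏ j ∈ Finset.range (n + 1), (σ + j)) * ‖∏ j ∈ Finset.range (n + 1), (h + j)‖ := by
      rw [norm_prod, norm_prod, ← Finset.prod_mul_distrib, ← Finset.prod_mul_distrib]
      exact Finset.prod_le_prod (fun j _ => by positivity) fun j _ => hfac j
    have hne : ∀ s : ℂ, 0 < s.re → 0 < ‖∏ j ∈ Finset.range (n + 1), (s + j)‖ := by
      intro s hs
      refine norm_pos_iff.2 (Finset.prod_ne_zero_iff.2 fun j _ h0 => ?_)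
      have := congrArg Complex.re h0
      simp only [Complex.add_re, Complex.natCast_re, Complex.zero_re] at this
      linarith [(Nat.cast_nonneg j : (0 : ℝ) ≤ j)]
    have hw0 := hne w hσ0
    have hh0 := hne h (by rw [hhre]; norm_num)
    have hp1 : 0 < ∏ j ∈ Finset.range (n + 1), (1 / 2 + j : ℝ) :=
      Finset.prod_pos fun j _ => by positivity
    have hp2 : 0 < ∏ j ∈ Finset.range (n + 1), (σ + j : ℝ) :=
      Finset.prod_pos fun j _ => by positivity
    have hc : ∀ s : ℂ, ‖(n : ℂ) ^ s‖ = (n : ℝ) ^ s.re := fun s => by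
      rw [← Complex.ofReal_natCast, Complex.norm_cpow_eq_rpow_re_of_pos hn']
    simp only [Complex.GammaSeq, Real.GammaSeq, norm_div, norm_mul, hc, hhre, ← hσ,
      Complex.norm_natCast]
    rw [div_mul_div_comm, div_mul_div_comm, div_le_div_iff₀ (by positivity) (by positivity)]
    have hX : (0 : ℝ) ≤ (n : ℝ) ^ (1 / 2 : ℝ) * n ! * ((n : ℝ) ^ σ * n !) := by positivity
    nlinarith [mul_le_mul_of_nonneg_left hprod hX]
  have hlim : ‖Complex.Gamma h‖ * Real.Gamma σ ≤ ‖Complex.Gamma w‖ * Real.Gamma (1 / 2) :=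
    le_of_tendsto_of_tendsto
      ((Complex.GammaSeq_tendsto_Gamma h).norm.mul (Real.GammaSeq_tendsto_Gamma σ))
      ((Complex.GammaSeq_tendsto_Gamma w).norm.mul (Real.GammaSeq_tendsto_Gamma (1 / 2)))
      ((eventually_gt_atTop 0).mono hseq)
  have hsq : ‖Complex.Gamma h‖ ^ 2 * Real.cosh (Real.pi * τ) = Real.pi := by
    have h1 : (1 : ℂ) - h = (starRingEnd ℂ) h := by
      apply Complex.ext
      · simp [hh]; norm_num
      · simp [hh]
    have h2 := Complex.Gamma_mul_Gamma_one_sub h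
    rw [h1, Complex.Gamma_conj, Complex.mul_conj] at h2
    have h3 : Complex.sin (Real.pi * h) = Real.cosh (Real.pi * τ) := by
      rw [hh, mul_add, show (Real.pi : ℂ) * (1 / 2) = Real.pi / 2 by ring, add_comm,
        Complex.sin_add_pi_div_two, ← mul_assoc, Complex.cos_mul_I]
      push_cast
      rfl
    rw [h3, eq_div_iff (by exact_mod_cast (Real.cosh_pos _).ne')] at h2
    rw [← Complex.normSq_eq_norm_sq]
    exact_mod_cast h2
  have hcosh : Real.cosh (Real.pi * τ) ≤ Real.exp (Real.pi * |τ|) := by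
    rw [← Real.cosh_abs, abs_mul, abs_of_pos Real.pi_pos, Real.cosh_eq]
    have : Real.exp (-(Real.pi * |τ|)) ≤ Real.exp (Real.pi * |τ|) :=
      Real.exp_le_exp.2 (by have := mul_nonneg Real.pi_pos.le (abs_nonneg τ); linarith)
    linarith
  have hlow : Real.sqrt Real.pi * Real.exp (-(Real.pi * |τ| / 2)) ≤ ‖Complex.Gamma h‖ := by
    refine abs_le_of_sq_le_sq' ?_ (norm_nonneg _) |>.2
    rw [mul_pow, Real.sq_sqrt Real.pi_pos.le, ← Real.exp_nat_mul]
    have he : ((2 : ℕ) : ℝ) * -(Real.pi * |τ| / 2) = -(Real.pi * |τ|) := by push_cast; ring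
    rw [he, Real.exp_neg, ← div_eq_mul_inv, div_le_iff₀ (Real.exp_pos _)]
    calc Real.pi = _ := hsq.symm
      _ ≤ _ := mul_le_mul_of_nonneg_left hcosh (sq_nonneg _)
  rw [Real.Gamma_one_half_eq] at hlim
  have hs : 0 < Real.sqrt Real.pi := Real.sqrt_pos.2 Real.pi_pos
  have hG := Real.Gamma_pos_of_pos hσ0
  nlinarith [mul_le_mul_of_nonneg_right hlow hG.le]

/-- For `|s| ≤ A` the Pochhammer symbol is at most `A (A + 1) ⋯ (A + n - 1)`, a factorial times a
binomial coefficient. -/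
theorem norm_ascPochhammer_eval_le {s : ℂ} {A : ℕ} (hs : ‖s‖ ≤ A) (n : ℕ) :
    ‖(ascPochhammer ℂ n).eval s‖ ≤ n ! * 2 ^ (A + n) := by
  have h1 : ‖(ascPochhammer ℂ n).eval s‖ ≤ (A.ascFactorial n : ℝ) := by
    induction n with
    | zero => simp
    | succ n ih =>
      rw [ascPochhammer_succ_eval, norm_mul, Nat.ascFactorial_succ, mul_comm]
      push_cast
      refine mul_le_mul ?_ ih (norm_nonneg _) (by positivity)
      exact (norm_add_le _ _).trans (by simpa using hs)
  refine h1.trans ?_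
  rw [Nat.ascFactorial_eq_factorial_mul_choose']
  push_cast
  gcongr
  calc ((A + n - 1).choose n : ℝ) ≤ 2 ^ (A + n - 1) := by exact_mod_cast Nat.choose_le_two_pow _ _
    _ ≤ 2 ^ (A + n) := pow_le_pow_right₀ one_le_two (Nat.sub_le _ _)

theorem inv_Gamma_eq_ascPochhammer_mul (s : ℂ) (m : ℕ) :
    (Complex.Gamma s)⁻¹ = (ascPochhammer ℂ m).eval s * (Complex.Gamma (s + m))⁻¹ := by
  induction m with
  | zero => simp
  | succ m ih =>
    rw [ih, ascPochhammer_succ_eval, Complex.one_div_Gamma_eq_self_mul_one_div_Gamma_add_one]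
    push_cast
    ring_nf

/-- A bound for `1 / Γ(c + n)` with the factor `1 / n!` needed for the convergence of the
hypergeometric series: shifting the argument by `m` moves it to the right half-plane, where
`Gamma_re_mul_exp_le_norm_Gamma` applies. -/
theorem norm_inv_Gamma_add_natCast_le {c : ℂ} {m : ℕ} (hc : ‖c‖ + 2 ≤ m) (n : ℕ) :
    ‖(Complex.Gamma (c + n))⁻¹‖ ≤ m ! * 2 ^ (2 * m + n) * Real.exp (2 * m) / n ! := by
  rw [inv_Gamma_eq_ascPochhammer_mul _ m, norm_mul, norm_inv]
  have h1 : ‖(ascPochhammer ℂ m).eval (c + n)‖ ≤ m ! * 2 ^ (2 * m + n) := by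
    have := norm_ascPochhammer_eval_le (s := c + n) (A := m + n)
      (by push_cast; exact (norm_add_le _ _).trans (by simp; linarith [norm_nonneg c])) m
    convert this using 3
    ring
  have hre : (n : ℝ) + 2 ≤ (c + n + m).re := by
    have := (abs_le.1 (Complex.abs_re_le_norm c)).1
    simp only [Complex.add_re, Complex.natCast_re]
    linarith
  have hn : (0 : ℝ) ≤ n := n.cast_nonneg
  have hG : (n ! : ℝ) ≤ Real.Gamma (c + n + m).re := by
    have h2 : Real.Gamma ((n : ℝ) + 2) ≤ Real.Gamma (c + n + m).re :=
      Real.Gamma_strictMonoOn_Ici.monotoneOn (Set.mem_Ici.2 (by linarith))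
        (Set.mem_Ici.2 (by linarith)) hre
    have h3 : Real.Gamma ((n : ℝ) + 2) = (n + 1) ! := by
      rw [← Real.Gamma_nat_eq_factorial]; push_cast; ring_nf
    rw [h3] at h2
    exact le_trans (by exact_mod_cast Nat.factorial_le (Nat.le_succ n)) h2
  have him : (c + n + m).im = c.im := by simp
  have h4 := Gamma_re_mul_exp_le_norm_Gamma (w := c + n + m) (by linarith)
  have h5 : Real.pi * |(c + n + m).im| / 2 ≤ 2 * m := by
    rw [him]
    have := Complex.abs_im_le_norm c
    have := Real.pi_le_four
    nlinarith [abs_nonneg c.im, Real.pi_pos]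
  have h6 : (n ! : ℝ) * Real.exp (-(2 * m)) ≤ ‖Complex.Gamma (c + n + m)‖ := by
    refine le_trans ?_ h4
    exact mul_le_mul hG (Real.exp_le_exp.2 (by linarith)) (Real.exp_pos _).le
      ((by positivity : (0 : ℝ) ≤ n !).trans hG)
  have h7 : 0 < (n ! : ℝ) * Real.exp (-(2 * m)) := by positivity
  calc _ ≤ (m ! * 2 ^ (2 * m + n) : ℝ) * ((n ! : ℝ) * Real.exp (-(2 * m)))⁻¹ := by gcongr
    _ = _ := by rw [Real.exp_neg]; field_simp

end Gamma

/-! ### The regularized hypergeometric function -/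

section Hypergeometric

open Complex (regularizedGaussHGFun regularizedGaussHGFunSeries)

/-- The coefficients of the regularized Gauss hypergeometric series. -/
noncomputable def hgCoeff (a b c : ℂ) (n : ℕ) : ℂ :=
  (ascPochhammer ℂ n).eval a * (ascPochhammer ℂ n).eval b * ((Complex.Gamma (c + n))⁻¹ / n !)

theorem hgCoeff_zero (a b c : ℂ) : hgCoeff a b c 0 = (Complex.Gamma c)⁻¹ := by
  simp [hgCoeff]

theorem regularizedGaussHGFunSeries_apply (a b c ζ : ℂ) (n : ℕ) :
    (regularizedGaussHGFunSeries a b c n fun _ => ζ) = hgCoeff a b c n * ζ ^ n := by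
  rw [FormalMultilinearSeries.apply_eq_pow_smul_coeff, Complex.coeff_regularizedGaussHGFunSeries,
    hgCoeff, smul_eq_mul, mul_comm]
  congr 1
  rw [div_eq_mul_inv, mul_inv, div_eq_mul_inv]
  ring

variable {a b c ζ : ℂ}

theorem summable_norm_hgCoeff (hζ : ‖ζ‖ < 1) : Summable fun n => ‖hgCoeff a b c n * ζ ^ n‖ := by
  have hr := Complex.radius_regularizedGaussHGFunSeries_ge_one a b c
  have := (regularizedGaussHGFunSeries a b c).summable_norm_apply (x := ζ)
    (Metric.eball_subset_eball hr (by simpa [enorm_eq_nnnorm, ← NNReal.coe_lt_one] using hζ))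
  simpa only [regularizedGaussHGFunSeries_apply] using this

theorem regularizedGaussHGFun_eq_tsum (ζ : ℂ) :
    regularizedGaussHGFun a b c ζ = ∑' n, hgCoeff a b c n * ζ ^ n :=
  tsum_congr fun n => regularizedGaussHGFunSeries_apply a b c ζ n

theorem hasSum_hgCoeff (hζ : ‖ζ‖ < 1) :
    HasSum (fun n => hgCoeff a b c n * ζ ^ n) (regularizedGaussHGFun a b c ζ) := by
  have h := (summable_norm_hgCoeff (a := a) (b := b) (c := c) hζ).of_norm.hasSum
  rwa [← regularizedGaussHGFun_eq_tsum] at h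

theorem regularizedGaussHGFun_zero (a b c : ℂ) :
    regularizedGaussHGFun a b c 0 = (Complex.Gamma c)⁻¹ := by
  rw [regularizedGaussHGFun_eq_tsum, tsum_eq_single 0, hgCoeff_zero, pow_zero, mul_one]
  intro n hn
  simp [hn]

/-- The two-term recurrence equivalent to the hypergeometric equation. Because of the
normalisation by `Γ(c + n)` it holds for all `c`, including the poles of `Γ`. -/
theorem succ_mul_hgCoeff_succ (a b c : ℂ) (n : ℕ) :
    ((n : ℂ) + 1) * (c + n) * hgCoeff a b c (n + 1) = (a + n) * (b + n) * hgCoeff a b c n := by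
  have h := Complex.one_div_Gamma_eq_self_mul_one_div_Gamma_add_one (c + n)
  have hn : ((n : ℂ) + 1) ≠ 0 := Nat.cast_add_one_ne_zero n
  have hn' : ((n ! : ℕ) : ℂ) ≠ 0 := Nat.cast_ne_zero.2 n.factorial_ne_zero
  simp only [hgCoeff, ascPochhammer_succ_eval, Nat.factorial_succ]
  rw [h]
  push_cast
  rw [← add_assoc]
  field_simp

theorem ascPochhammer_succ_eval_left (n : ℕ) (s : ℂ) :
    (ascPochhammer ℂ (n + 1)).eval s = s * (ascPochhammer ℂ n).eval (s + 1) := by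
  rw [ascPochhammer_succ_left]
  simp [Polynomial.eval_comp]

/-- Differentiating the series shifts all parameters by one. -/
theorem succ_mul_hgCoeff_succ_eq (a b c : ℂ) (n : ℕ) :
    ((n : ℂ) + 1) * hgCoeff a b c (n + 1) = a * b * hgCoeff (a + 1) (b + 1) (c + 1) n := by
  have hn : ((n : ℂ) + 1) ≠ 0 := Nat.cast_add_one_ne_zero n
  have hn' : ((n ! : ℕ) : ℂ) ≠ 0 := Nat.cast_ne_zero.2 n.factorial_ne_zero
  simp only [hgCoeff, ascPochhammer_succ_eval_left, Nat.factorial_succ]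
  rw [show c + 1 + (n : ℂ) = c + ((n + 1 : ℕ) : ℂ) by push_cast; ring]
  push_cast
  field_simp

/-- The derivative in the variable is the function with shifted parameters. -/
theorem hasDerivAt_regularizedGaussHGFun (hζ : ‖ζ‖ < 1) :
    HasDerivAt (regularizedGaussHGFun a b c)
      (a * b * regularizedGaussHGFun (a + 1) (b + 1) (c + 1) ζ) ζ := by
  obtain ⟨r, hr, hr1⟩ := exists_between hζ
  have hr0 : 0 < r := (norm_nonneg _).trans_lt hr
  have hrn : ‖(r : ℂ)‖ < 1 := by simpa [abs_of_pos hr0] using hr1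
  -- the derivative of the series, term by term, dominated on the disc of radius `r`
  have hu : Summable fun n : ℕ => ‖(n : ℂ) * hgCoeff a b c n‖ * r ^ (n - 1) := by
    rw [← summable_nat_add_iff 1]
    have := (summable_norm_hgCoeff (a := a + 1) (b := b + 1) (c := c + 1) hrn).mul_left ‖a * b‖
    refine this.congr fun n => ?_
    rw [← norm_mul, ← mul_assoc, ← succ_mul_hgCoeff_succ_eq, norm_mul, norm_pow]
    simp [abs_of_pos hr0]
  have key := hasDerivAt_tsum_of_isPreconnected (𝕜 := ℂ)
    (g := fun n w => hgCoeff a b c n * w ^ n)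
    (g' := fun n w => hgCoeff a b c n * (n * w ^ (n - 1))) hu
    (t := Metric.ball 0 r) Metric.isOpen_ball (convex_ball _ _).isPreconnected
    (fun n w _ => (hasDerivAt_pow n w).const_mul _)
    (fun n w hw => by
      have hw' : ‖w‖ ≤ r := (mem_ball_zero_iff.1 hw).le
      rw [← mul_assoc, norm_mul, mul_comm (hgCoeff a b c n), norm_pow]
      gcongr)
    (y₀ := ζ) (y := ζ) (mem_ball_zero_iff.2 hr) (hasSum_hgCoeff hζ).summable
    (mem_ball_zero_iff.2 hr)
  have hs : Summable fun n : ℕ => hgCoeff a b c n * (n * ζ ^ (n - 1)) := by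
    refine .of_norm_bounded hu fun n => ?_
    rw [← mul_assoc, norm_mul, mul_comm (hgCoeff a b c n), norm_pow]
    gcongr
  rw [hs.tsum_eq_zero_add] at key
  have hd : (∑' n : ℕ, hgCoeff a b c (n + 1) * (((n + 1 : ℕ) : ℂ) * ζ ^ (n + 1 - 1))) =
      a * b * regularizedGaussHGFun (a + 1) (b + 1) (c + 1) ζ := by
    rw [regularizedGaussHGFun_eq_tsum, ← tsum_mul_left]
    refine tsum_congr fun n => ?_
    rw [← mul_assoc (a * b), ← succ_mul_hgCoeff_succ_eq]
    rw [Nat.add_sub_cancel]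
    push_cast
    ring
  rw [hd] at key
  simp only [Nat.cast_zero, zero_mul, mul_zero, zero_add] at key
  exact key.congr_of_eventuallyEq (.of_forall fun w => regularizedGaussHGFun_eq_tsum w)

/-- The hypergeometric differential equation, with the derivatives written as hypergeometric
functions with shifted parameters. -/
theorem hypergeometric_equation (hζ : ‖ζ‖ < 1) :
    ζ * (1 - ζ) * (a * b * ((a + 1) * (b + 1) *
        regularizedGaussHGFun (a + 1 + 1) (b + 1 + 1) (c + 1 + 1) ζ)) +
      (c - (a + b + 1) * ζ) * (a * b * regularizedGaussHGFun (a + 1) (b + 1) (c + 1) ζ) -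
      a * b * regularizedGaussHGFun a b c ζ = 0 := by
  set t := hgCoeff a b c with ht
  have h0 := hasSum_hgCoeff (a := a) (b := b) (c := c) hζ
  have h1 : HasSum (fun n : ℕ => ((n : ℂ) + 1) * t (n + 1) * ζ ^ n)
      (a * b * regularizedGaussHGFun (a + 1) (b + 1) (c + 1) ζ) := by
    refine ((hasSum_hgCoeff hζ).mul_left (a * b)).congr_fun fun n => ?_
    rw [ht, succ_mul_hgCoeff_succ_eq]; ring
  have h2 : HasSum (fun n : ℕ => ((n : ℂ) + 1) * ((n + 2) * t (n + 2)) * ζ ^ n)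
      (a * b * ((a + 1) * (b + 1) *
        regularizedGaussHGFun (a + 1 + 1) (b + 1 + 1) (c + 1 + 1) ζ)) := by
    refine (((hasSum_hgCoeff hζ).mul_left ((a + 1) * (b + 1))).mul_left (a * b)).congr_fun
      fun n => ?_
    have e1 := succ_mul_hgCoeff_succ_eq (a + 1) (b + 1) (c + 1) n
    have e2 := succ_mul_hgCoeff_succ_eq a b c (n + 1)
    push_cast at e2
    have e3 : ((n : ℂ) + 2) * t (n + 2) = a * b * hgCoeff (a + 1) (b + 1) (c + 1) (n + 1) := by
      rw [← e2, ht]; ring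
    rw [e3, ← mul_assoc ((a + 1) * (b + 1)), ← e1]
    ring
  have h1s : HasSum (fun n : ℕ => (n : ℂ) * t n * ζ ^ n)
      (ζ * (a * b * regularizedGaussHGFun (a + 1) (b + 1) (c + 1) ζ)) := by
    rw [← hasSum_nat_add_iff' 1]
    simp only [Finset.sum_range_one, Nat.cast_zero, zero_mul, sub_zero]
    refine (h1.mul_left ζ).congr_fun fun n => ?_
    push_cast; ring
  have h2s : HasSum (fun n : ℕ => (n : ℂ) * ((n + 1) * t (n + 1)) * ζ ^ n)
      (ζ * (a * b * ((a + 1) * (b + 1) *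
        regularizedGaussHGFun (a + 1 + 1) (b + 1 + 1) (c + 1 + 1) ζ))) := by
    rw [← hasSum_nat_add_iff' 1]
    simp only [Finset.sum_range_one, Nat.cast_zero, zero_mul, sub_zero]
    refine (h2.mul_left ζ).congr_fun fun n => ?_
    push_cast; ring
  have h2ss : HasSum (fun n : ℕ => ((n : ℂ) - 1) * (n * t n) * ζ ^ n)
      (ζ * (ζ * (a * b * ((a + 1) * (b + 1) *
        regularizedGaussHGFun (a + 1 + 1) (b + 1 + 1) (c + 1 + 1) ζ)))) := by
    rw [← hasSum_nat_add_iff' 1]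
    simp only [Finset.sum_range_one, Nat.cast_zero, zero_mul, mul_zero, sub_zero]
    refine (h2s.mul_left ζ).congr_fun fun n => ?_
    push_cast; ring
  have hall := ((h2s.sub h2ss).add ((h1.mul_left c).sub (h1s.mul_left (a + b + 1)))).sub
    (h0.mul_left (a * b))
  have hz := hall.unique (hasSum_zero.congr_fun fun n => ?_)
  · rw [← hz]; ring
  · have := succ_mul_hgCoeff_succ a b c n
    rw [← ht] at this ⊢
    linear_combination (ζ ^ n) * this

/-- A bound for the coefficients that is locally uniform in the parameters and of order one in
them; the `n!` from the two Pochhammer symbols cancel against those in the denominator. -/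
theorem norm_hgCoeff_le {M : ℕ} (ha : ‖a‖ ≤ M) (hb : ‖b‖ ≤ M) (hc : ‖c‖ + 2 ≤ M) (n : ℕ) :
    ‖hgCoeff a b c n‖ ≤ M ! * (16 * Real.exp 2) ^ M * 8 ^ n := by
  have h1 := norm_ascPochhammer_eval_le ha n
  have h2 := norm_ascPochhammer_eval_le hb n
  have h3 := norm_inv_Gamma_add_natCast_le hc n
  rw [hgCoeff, norm_mul, norm_mul, norm_div, Complex.norm_natCast]
  calc _ ≤ ((n ! : ℝ) * 2 ^ (M + n)) * (n ! * 2 ^ (M + n)) *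
        (M ! * 2 ^ (2 * M + n) * Real.exp (2 * M) / n ! / n !) := by gcongr
    _ = _ := by
      rw [show (2 : ℝ) * M = M * 2 by ring, Real.exp_nat_mul, mul_pow (16 : ℝ),
        show (16 : ℝ) = 2 ^ 4 by norm_num, show (8 : ℝ) = 2 ^ 3 by norm_num, ← pow_mul, ← pow_mul]
      field_simp
      ring

/-- For `|ζ| ≤ 1/16` the bound `8^n` for the coefficients makes the series converge
geometrically. -/
theorem norm_regularizedGaussHGFun_le {M : ℕ} (ha : ‖a‖ ≤ M) (hb : ‖b‖ ≤ M) (hc : ‖c‖ + 2 ≤ M)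
    (hζ : ‖ζ‖ ≤ 1 / 16) :
    ‖regularizedGaussHGFun a b c ζ‖ ≤ 2 * (M ! * (16 * Real.exp 2) ^ M) := by
  rw [regularizedGaussHGFun_eq_tsum]
  refine tsum_of_norm_bounded (g := fun n : ℕ => M ! * (16 * Real.exp 2) ^ M * (1 / 2 : ℝ) ^ n)
    ?_ fun n => ?_
  · rw [mul_comm 2]
    exact hasSum_geometric_two.mul_left _
  · rw [norm_mul, norm_pow]
    calc _ ≤ M ! * (16 * Real.exp 2) ^ M * 8 ^ n * (1 / 16 : ℝ) ^ n := by
          gcongr; exact norm_hgCoeff_le ha hb hc n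
      _ = _ := by rw [mul_assoc, ← mul_pow]; norm_num

theorem differentiable_regularizedGaussHGFun {a b c : ℂ → ℂ} (ha : Differentiable ℂ a)
    (hb : Differentiable ℂ b) (hc : Differentiable ℂ c) (hζ : ‖ζ‖ ≤ 1 / 16) :
    Differentiable ℂ fun z => regularizedGaussHGFun (a z) (b z) (c z) ζ := by
  intro z₀
  have hbd : ∀ f : ℂ → ℂ, Differentiable ℂ f → ∃ M : ℝ, ∀ z ∈ Metric.ball z₀ 1, ‖f z‖ ≤ M := by
    intro f hf
    obtain ⟨M, hM⟩ := (isCompact_closedBall z₀ 1).exists_bound_of_continuousOn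
      hf.continuous.continuousOn
    exact ⟨M, fun z hz => hM z (Metric.ball_subset_closedBall hz)⟩
  obtain ⟨Ma, hMa⟩ := hbd a ha
  obtain ⟨Mb, hMb⟩ := hbd b hb
  obtain ⟨Mc, hMc⟩ := hbd c hc
  obtain ⟨M, hM⟩ := exists_nat_ge (max Ma (max Mb (Mc + 2)))
  simp only [max_le_iff] at hM
  simp only [regularizedGaussHGFun_eq_tsum]
  refine (Complex.differentiableOn_tsum_of_summable_norm
    (u := fun n : ℕ => M ! * (16 * Real.exp 2) ^ M * (1 / 2 : ℝ) ^ n)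
    (summable_geometric_two.mul_left _) (fun n => Differentiable.differentiableOn ?_)
    Metric.isOpen_ball (fun n z hz => ?_)).differentiableAt (Metric.ball_mem_nhds z₀ one_pos)
  · have hp : ∀ f : ℂ → ℂ, Differentiable ℂ f →
        Differentiable ℂ fun z => (ascPochhammer ℂ n).eval (f z) :=
      fun f hf => (ascPochhammer ℂ n).differentiable.comp hf
    have hG : Differentiable ℂ fun z => (Complex.Gamma (c z + n))⁻¹ :=
      Complex.differentiable_one_div_Gamma.comp (hc.add_const _)
    exact (((hp a ha).mul (hp b hb)).mul (hG.div_const _)).mul_const _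
  · rw [norm_mul, norm_pow]
    calc _ ≤ M ! * (16 * Real.exp 2) ^ M * 8 ^ n * (1 / 16 : ℝ) ^ n := by
          gcongr
          exact norm_hgCoeff_le ((hMa z hz).trans hM.1) ((hMb z hz).trans hM.2.1)
            ((add_le_add_left (hMc z hz) 2).trans hM.2.2) n
      _ = _ := by rw [mul_assoc, ← mul_pow]; norm_num

end Hypergeometric

/-! ### Growth of order at most one -/

section Growth

/-- The growth of `B` is of order at most one: `B z = O(exp (|z|^{1+ε}))` for every `ε > 0`. -/
def GrowthAtMostOne (B : ℂ → ℝ) : Prop :=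
  ∀ ε : ℝ, 0 < ε → ∃ C : ℝ, ∀ z : ℂ, B z ≤ C * Real.exp (‖z‖ ^ (1 + ε))

theorem exists_mul_rpow_le (k : ℝ) {δ ε : ℝ} (hδ : 0 ≤ δ) (hε : δ < ε) :
    ∃ D : ℝ, ∀ x : ℝ, 0 ≤ x → k * x ^ (1 + δ) ≤ x ^ (1 + ε) + D := by
  set m := max k 0
  -- the two powers of `x` cross at `x = m^{1/(ε - δ)}`
  refine ⟨m * (m ^ (ε - δ)⁻¹) ^ (1 + δ), fun x hx => ?_⟩
  have hm : 0 ≤ m := le_max_right _ _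
  have h1 : k * x ^ (1 + δ) ≤ m * x ^ (1 + δ) := by gcongr; exact le_max_left _ _
  refine h1.trans ?_
  rcases le_total (m ^ (ε - δ)⁻¹) x with h | h
  · have h2 : m ≤ x ^ (ε - δ) := by
      calc m = (m ^ (ε - δ)⁻¹) ^ (ε - δ) := by
            rw [← Real.rpow_mul hm, inv_mul_cancel₀ (sub_pos.2 hε).ne', Real.rpow_one]
        _ ≤ x ^ (ε - δ) := Real.rpow_le_rpow (by positivity) h (sub_pos.2 hε).le
    have h3 : x ^ (1 + ε) = x ^ (ε - δ) * x ^ (1 + δ) := by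
      rw [← Real.rpow_add' hx (by linarith)]; ring_nf
    have h4 : m * x ^ (1 + δ) ≤ x ^ (1 + ε) := by rw [h3]; gcongr
    have : 0 ≤ m * (m ^ (ε - δ)⁻¹) ^ (1 + δ) := by positivity
    linarith
  · have h4 : m * x ^ (1 + δ) ≤ m * (m ^ (ε - δ)⁻¹) ^ (1 + δ) := by gcongr
    have : 0 ≤ x ^ (1 + ε) := by positivity
    linarith

/-- A bound `exp (k |z|^{1+δ} + D)` with `δ` arbitrarily small gives growth of order at most
one. -/
theorem GrowthAtMostOne.of_exp {B : ℂ → ℝ} (h : ∀ δ : ℝ, 0 < δ → ∃ C k : ℝ, 0 ≤ C ∧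
    ∀ z, B z ≤ C * Real.exp (k * ‖z‖ ^ (1 + δ))) : GrowthAtMostOne B := by
  intro ε hε
  obtain ⟨C, k, hC, hB⟩ := h (ε / 2) (by linarith)
  obtain ⟨D, hD⟩ := exists_mul_rpow_le k (by linarith : 0 ≤ ε / 2) (by linarith : ε / 2 < ε)
  refine ⟨C * Real.exp D, fun z => (hB z).trans ?_⟩
  rw [mul_assoc, ← Real.exp_add]
  gcongr
  linarith [hD ‖z‖ (norm_nonneg z)]

variable {B B₂ : ℂ → ℝ}

theorem GrowthAtMostOne.mono (h : GrowthAtMostOne B) (hle : ∀ z, B₂ z ≤ B z) :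
    GrowthAtMostOne B₂ := fun ε hε =>
  let ⟨C, hC⟩ := h ε hε
  ⟨C, fun z => (hle z).trans (hC z)⟩

theorem GrowthAtMostOne.add (h : GrowthAtMostOne B) (h₂ : GrowthAtMostOne B₂) :
    GrowthAtMostOne fun z => B z + B₂ z := by
  intro ε hε
  obtain ⟨C, hC⟩ := h ε hε
  obtain ⟨C₂, hC₂⟩ := h₂ ε hε
  exact ⟨C + C₂, fun z => by rw [add_mul]; exact add_le_add (hC z) (hC₂ z)⟩

theorem GrowthAtMostOne.mul (h : GrowthAtMostOne B) (h₂ : GrowthAtMostOne B₂)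
    (h0 : ∀ z, 0 ≤ B z) (h0₂ : ∀ z, 0 ≤ B₂ z) : GrowthAtMostOne fun z => B z * B₂ z := by
  refine .of_exp fun δ hδ => ?_
  obtain ⟨C, hC⟩ := h δ hδ
  obtain ⟨C₂, hC₂⟩ := h₂ δ hδ
  have hp : ∀ {C : ℝ} {B : ℂ → ℝ}, (∀ z, 0 ≤ B z) →
      (∀ z, B z ≤ C * Real.exp (‖z‖ ^ (1 + δ))) → 0 ≤ C := fun h1 h2 =>
    nonneg_of_mul_nonneg_left ((h1 0).trans (h2 0)) (Real.exp_pos _)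
  refine ⟨C * C₂, 2, mul_nonneg (hp h0 hC) (hp h0₂ hC₂), fun z => ?_⟩
  calc B z * B₂ z ≤ (C * Real.exp (‖z‖ ^ (1 + δ))) * (C₂ * Real.exp (‖z‖ ^ (1 + δ))) :=
        mul_le_mul (hC z) (hC₂ z) (h0₂ z) ((h0 z).trans (hC z))
    _ = _ := by rw [two_mul, Real.exp_add]; ring

theorem growthAtMostOne_const (c : ℝ) : GrowthAtMostOne fun _ => c := by
  intro ε _
  refine ⟨|c|, fun z => (le_abs_self c).trans (le_mul_of_one_le_right (abs_nonneg c) ?_)⟩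
  exact Real.one_le_exp (by positivity)

theorem growthAtMostOne_exp (k : ℝ) : GrowthAtMostOne fun z => Real.exp (k * ‖z‖) := by
  intro ε hε
  obtain ⟨D, hD⟩ := exists_mul_rpow_le k le_rfl hε
  refine ⟨Real.exp D, fun z => ?_⟩
  rw [← Real.exp_add]
  have := hD ‖z‖ (norm_nonneg z)
  rw [add_zero, Real.rpow_one] at this
  exact Real.exp_le_exp.2 (by linarith)

theorem growthAtMostOne_norm : GrowthAtMostOne fun z => ‖z‖ :=
  (growthAtMostOne_exp 1).mono fun z => by
    rw [one_mul]; linarith [Real.add_one_le_exp ‖z‖]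

/-- Stirling-type growth: `M! K^M` with `M = |z| + O(1)` is of order at most one. -/
theorem growthAtMostOne_factorial (N : ℕ) {K : ℝ} (hK : 1 ≤ K) :
    GrowthAtMostOne fun z => ((⌈‖z‖⌉₊ + N) ! : ℝ) * K ^ (⌈‖z‖⌉₊ + N) := by
  refine .of_exp fun δ hδ => ?_
  set L : ℝ := N + 1 with hL
  have hL0 : 0 < L := by positivity
  -- `M log (K M) ≤ K^δ M^{1+δ} / δ` and `M ≤ |z| + L ≤ 2 max (|z|, L)`
  set k : ℝ := K ^ δ / δ * 2 ^ (1 + δ) with hk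
  have hk0 : 0 ≤ k := by positivity
  refine ⟨Real.exp (k * L ^ (1 + δ)), k, (Real.exp_pos _).le, fun z => ?_⟩
  set M := ⌈‖z‖⌉₊ + N with hM
  have hML : (M : ℝ) ≤ ‖z‖ + L := by
    have := (Nat.ceil_lt_add_one (norm_nonneg z)).le
    rw [hM]; push_cast; linarith
  have h1 : (M ! : ℝ) * K ^ M ≤ ((M : ℝ) * K) ^ M := by
    rw [mul_pow]; gcongr; exact_mod_cast Nat.factorial_le_pow M
  refine h1.trans ?_
  rw [← Real.exp_add]
  rcases Nat.eq_zero_or_pos M with h0 | h0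
  · rw [h0, pow_zero]; exact Real.one_le_exp (by positivity)
  have hM0 : (0 : ℝ) < M := Nat.cast_pos.2 h0
  have hMK : 0 < (M : ℝ) * K := by positivity
  rw [← Real.exp_log (pow_pos hMK M), Real.log_pow]
  refine Real.exp_le_exp.2 ?_
  have h2 : Real.log (M * K) ≤ (M * K) ^ δ / δ := Real.log_le_rpow_div hMK.le hδ
  have h3 : (M : ℝ) ^ (1 + δ) ≤ 2 ^ (1 + δ) * (L ^ (1 + δ) + ‖z‖ ^ (1 + δ)) := by
    have h4 : (M : ℝ) ≤ 2 * max L ‖z‖ := by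
      have := le_max_left L ‖z‖
      have := le_max_right L ‖z‖
      linarith
    calc (M : ℝ) ^ (1 + δ) ≤ (2 * max L ‖z‖) ^ (1 + δ) := by gcongr
      _ = 2 ^ (1 + δ) * (max L ‖z‖) ^ (1 + δ) :=
          Real.mul_rpow zero_le_two (hL0.le.trans (le_max_left _ _))
      _ ≤ _ := by
          gcongr
          have h5 : 0 ≤ L ^ (1 + δ) := by positivity
          have h6 : 0 ≤ ‖z‖ ^ (1 + δ) := by positivity
          rcases max_choice L ‖z‖ with h | h <;> rw [h] <;> linarith
  calc (M : ℝ) * Real.log (M * K) ≤ M * ((M * K) ^ δ / δ) := by gcongr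
    _ = K ^ δ / δ * (M : ℝ) ^ (1 + δ) := by
        rw [Real.mul_rpow hM0.le (by linarith), Real.rpow_one_add' hM0.le (by linarith)]; ring
    _ ≤ K ^ δ / δ * (2 ^ (1 + δ) * (L ^ (1 + δ) + ‖z‖ ^ (1 + δ))) := by gcongr
    _ = _ := by rw [hk]; ring

variable {f g : ℂ → ℂ}

theorem isEntireOfOrderAtMostOne_iff : IsEntireOfOrderAtMostOne f ↔
    Differentiable ℂ f ∧ GrowthAtMostOne fun z => ‖f z‖ := Iff.rfl

theorem IsEntireOfOrderAtMostOne.mul (hf : IsEntireOfOrderAtMostOne f)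
    (hg : IsEntireOfOrderAtMostOne g) : IsEntireOfOrderAtMostOne fun z => f z * g z := by
  rw [isEntireOfOrderAtMostOne_iff] at *
  exact ⟨hf.1.mul hg.1, by
    simpa only [norm_mul] using hf.2.mul hg.2 (fun _ => norm_nonneg _) fun _ => norm_nonneg _⟩

theorem IsEntireOfOrderAtMostOne.add (hf : IsEntireOfOrderAtMostOne f)
    (hg : IsEntireOfOrderAtMostOne g) : IsEntireOfOrderAtMostOne fun z => f z + g z := by
  rw [isEntireOfOrderAtMostOne_iff] at *
  exact ⟨hf.1.add hg.1, (hf.2.add hg.2).mono fun z => norm_add_le _ _⟩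

theorem IsEntireOfOrderAtMostOne.sub (hf : IsEntireOfOrderAtMostOne f)
    (hg : IsEntireOfOrderAtMostOne g) : IsEntireOfOrderAtMostOne fun z => f z - g z := by
  rw [isEntireOfOrderAtMostOne_iff] at *
  exact ⟨hf.1.sub hg.1, (hf.2.add hg.2).mono fun z => norm_sub_le _ _⟩

theorem isEntireOfOrderAtMostOne_const (c : ℂ) : IsEntireOfOrderAtMostOne fun _ => c :=
  isEntireOfOrderAtMostOne_iff.2 ⟨differentiable_const c, growthAtMostOne_const _⟩

theorem isEntireOfOrderAtMostOne_id : IsEntireOfOrderAtMostOne fun z => z :=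
  isEntireOfOrderAtMostOne_iff.2 ⟨differentiable_id, growthAtMostOne_norm⟩

theorem IsEntireOfOrderAtMostOne.pow (hf : IsEntireOfOrderAtMostOne f) (n : ℕ) :
    IsEntireOfOrderAtMostOne fun z => f z ^ n := by
  induction n with
  | zero => simpa using isEntireOfOrderAtMostOne_const 1
  | succ n ih => simpa only [pow_succ] using ih.mul hf

end Growth

/-! ### The free Jost solutions -/

section FreeSolution

open Complex (regularizedGaussHGFun)

/-- The argument `1 / (1 + e^{2x})` of the hypergeometric function in the free Jost solution. It
decreases from `1` to `0`. -/
noncomputable def hgVar (x : ℝ) : ℝ := 1 / (1 + Real.exp (2 * x))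

theorem hgVar_pos (x : ℝ) : 0 < hgVar x := by unfold hgVar; positivity

theorem hgVar_lt_one (x : ℝ) : hgVar x < 1 := by
  unfold hgVar
  rw [div_lt_one (by positivity)]
  linarith [Real.exp_pos (2 * x)]

theorem norm_hgVar (x : ℝ) : ‖(hgVar x : ℂ)‖ = hgVar x := by
  rw [Complex.norm_real, Real.norm_eq_abs, abs_of_pos (hgVar_pos x)]

theorem norm_hgVar_lt_one (x : ℝ) : ‖(hgVar x : ℂ)‖ < 1 := (norm_hgVar x).trans_lt (hgVar_lt_one x)

/-- To the right of `2` the argument lies in the disc where the hypergeometric series converges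
uniformly in its parameters. -/
theorem hgVar_le {x : ℝ} (hx : 2 ≤ x) : hgVar x ≤ 1 / 16 := by
  unfold hgVar
  refine one_div_le_one_div_of_le (by norm_num) ?_
  have h1 : Real.exp 1 ^ 4 ≤ Real.exp (2 * x) := by
    rw [← Real.exp_nat_mul]; exact Real.exp_le_exp.2 (by norm_num; linarith)
  have h2 : (2 : ℝ) ^ 4 ≤ Real.exp 1 ^ 4 :=
    pow_le_pow_left₀ zero_le_two (by linarith [Real.exp_one_gt_d9]) 4
  linarith

theorem hasDerivAt_hgVar (x : ℝ) : HasDerivAt hgVar (-2 * hgVar x * (1 - hgVar x)) x := by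
  have h0 : (1 + Real.exp (2 * x)) ≠ 0 := by positivity
  have h := ((((hasDerivAt_id x).const_mul 2).exp).const_add 1).inv h0
  have he : hgVar = fun x => (1 + Real.exp (2 * x))⁻¹ := by funext y; simp [hgVar]
  rw [he]
  refine h.congr_deriv ?_
  simp only [id]
  field_simp
  ring

theorem tendsto_hgVar : Tendsto hgVar atTop (𝓝 0) := by
  have h1 : Tendsto (fun x : ℝ => 1 + Real.exp (2 * x)) atTop atTop :=
    tendsto_atTop_add_const_left _ _
      (Real.tendsto_exp_atTop.comp (tendsto_id.const_mul_atTop zero_lt_two))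
  exact h1.inv_tendsto_atTop.congr fun x => (one_div _).symm

theorem one_div_cosh_sq (x : ℝ) : 1 / Real.cosh x ^ 2 = 4 * hgVar x * (1 - hgVar x) := by
  have h0 : (1 + Real.exp (2 * x)) ≠ 0 := by positivity
  have hx : Real.exp (2 * x) = Real.exp x ^ 2 := by rw [← Real.exp_nat_mul]; norm_num
  have hp := Real.exp_pos x
  rw [hgVar, Real.cosh_eq, Real.exp_neg, hx]
  field_simp
  ring

theorem sinh_div_cosh (x : ℝ) : Real.sinh x / Real.cosh x = 1 - 2 * hgVar x := by
  have hx : Real.exp (2 * x) = Real.exp x ^ 2 := by rw [← Real.exp_nat_mul]; norm_num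
  have hp := Real.exp_pos x
  rw [hgVar, Real.cosh_eq, Real.sinh_eq, Real.exp_neg, hx]
  field_simp
  ring

/-- The prefactor `(2 cosh x)^{iz}` of the free Jost solutions. -/
noncomputable def coshPow (z : ℂ) (x : ℝ) : ℂ := ((2 * Real.cosh x : ℝ) : ℂ) ^ (Complex.I * z)

theorem coshPow_eq (z : ℂ) (x : ℝ) :
    coshPow z x = Complex.exp (Real.log (2 * Real.cosh x) * (Complex.I * z)) := by
  have : (0 : ℝ) < 2 * Real.cosh x := by positivity
  rw [coshPow, Complex.cpow_def_of_ne_zero (by exact_mod_cast this.ne'), Complex.ofReal_log this.le]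

theorem coshPow_neg_mul (z : ℂ) (x : ℝ) : coshPow (-z) x * coshPow z x = 1 := by
  rw [coshPow_eq, coshPow_eq, ← Complex.exp_add, ← Complex.exp_zero]
  congr 1; ring

theorem hasDerivAt_coshPow (z : ℂ) (x : ℝ) :
    HasDerivAt (coshPow z) (Complex.I * z * (1 - 2 * hgVar x) * coshPow z x) x := by
  have hp : (2 * Real.cosh x) ≠ 0 := by positivity
  have h1 : HasDerivAt (fun x => Real.log (2 * Real.cosh x)) (1 - 2 * hgVar x) x := by
    refine (((Real.hasDerivAt_cosh x).const_mul 2).log hp).congr_deriv ?_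
    rw [← sinh_div_cosh, mul_div_mul_left _ _ two_ne_zero]
  have h2 := (h1.ofReal_comp.mul_const (Complex.I * z)).cexp
  rw [funext (coshPow_eq z)]
  refine h2.congr_deriv ?_
  push_cast
  ring

theorem isEntireOfOrderAtMostOne_coshPow (x : ℝ) :
    IsEntireOfOrderAtMostOne fun z => coshPow z x := by
  rw [isEntireOfOrderAtMostOne_iff]
  simp only [coshPow_eq]
  refine ⟨by fun_prop, (growthAtMostOne_exp |Real.log (2 * Real.cosh x)|).mono fun z => ?_⟩
  rw [Complex.norm_exp]
  refine Real.exp_le_exp.2 ((Complex.re_le_norm _).trans ?_)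
  simp

theorem realSqrt_sq (x : ℝ) : realSqrt x ^ 2 = x := by
  unfold realSqrt
  split_ifs with h
  · rw [← Complex.ofReal_pow, Real.sq_sqrt h]
  · rw [mul_pow, Complex.I_sq, ← Complex.ofReal_pow, Real.sq_sqrt (by linarith)]
    push_cast; ring

theorem paramA_mul_paramB (lam : ℝ) (z : ℂ) :
    paramA lam z * paramB lam z = lam - Complex.I * z - z ^ 2 := by
  have h := realSqrt_sq (1 / 4 - lam)
  push_cast at h
  simp only [paramA, paramB]
  linear_combination -h + z ^ 2 * Complex.I_sq

theorem paramA_add_paramB (lam : ℝ) (z : ℂ) :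
    paramA lam z + paramB lam z + 1 = 2 * paramC z := by
  simp only [paramA, paramB, paramC]; ring

/-- All three parameters grow linearly in `z`, so the bound `M! K^M` with `M = |z| + O(1)`
applies. -/
theorem isEntireOfOrderAtMostOne_regularizedGaussHGFun {ζ α β γ : ℂ} (hζ : ‖ζ‖ ≤ 1 / 16) :
    IsEntireOfOrderAtMostOne fun z => regularizedGaussHGFun (α - Complex.I * z)
      (β - Complex.I * z) (γ - Complex.I * z) ζ := by
  rw [isEntireOfOrderAtMostOne_iff]
  refine ⟨differentiable_regularizedGaussHGFun (by fun_prop) (by fun_prop) (by fun_prop) hζ, ?_⟩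
  obtain ⟨N, hN⟩ := exists_nat_ge (‖α‖ + ‖β‖ + ‖γ‖ + 2)
  have hK : (1 : ℝ) ≤ 16 * Real.exp 2 := by linarith [Real.add_one_le_exp (2 : ℝ)]
  refine ((growthAtMostOne_const 2).mul (growthAtMostOne_factorial N hK) (fun _ => zero_le_two)
    (fun _ => by positivity)).mono fun z => ?_
  have hz := Nat.le_ceil ‖z‖
  have hsub : ∀ s : ℂ, ‖s - Complex.I * z‖ ≤ ‖s‖ + ‖z‖ := fun s =>
    (norm_sub_le _ _).trans (by simp)
  refine norm_regularizedGaussHGFun_le ((hsub _).trans ?_) ((hsub _).trans ?_)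
    ((add_le_add_left (hsub _) 2).trans ?_) hζ <;>
  · push_cast
    linarith [norm_nonneg α, norm_nonneg β, norm_nonneg γ]

variable (lam : ℝ) (z : ℂ) (x : ℝ)

theorem freeJostPlus_eq : freeJostPlus lam z x = coshPow z x *
    regularizedGaussHGFun (paramA lam z) (paramB lam z) (paramC z) (hgVar x : ℂ) := rfl

theorem freeJostMinus_eq : freeJostMinus lam z x = freeJostPlus lam z (-x) := by
  have h : Real.exp (2 * x) / (1 + Real.exp (2 * x)) = hgVar (-x) := by
    rw [hgVar, mul_neg, Real.exp_neg]
    have := Real.exp_pos (2 * x)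
    field_simp
    ring
  rw [freeJostPlus_eq, ← h, freeJostMinus, coshPow, Real.cosh_neg]

/-- The derivative in `x` of the free Jost solution `freeJostPlus`. -/
noncomputable def freeJostPlusDeriv : ℂ := coshPow z x *
  (Complex.I * z * (1 - 2 * hgVar x) *
    regularizedGaussHGFun (paramA lam z) (paramB lam z) (paramC z) (hgVar x : ℂ) -
  2 * hgVar x * (1 - hgVar x) * (paramA lam z * paramB lam z *
    regularizedGaussHGFun (paramA lam z + 1) (paramB lam z + 1) (paramC z + 1) (hgVar x : ℂ)))

theorem hasDerivAt_regularizedGaussHGFun_hgVar (a b c : ℂ) :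
    HasDerivAt (fun x => regularizedGaussHGFun a b c (hgVar x : ℂ))
      (a * b * regularizedGaussHGFun (a + 1) (b + 1) (c + 1) (hgVar x : ℂ) *
        (-2 * hgVar x * (1 - hgVar x))) x := by
  have h := (hasDerivAt_regularizedGaussHGFun (a := a) (b := b) (c := c)
    (norm_hgVar_lt_one x)).comp x (hasDerivAt_hgVar x).ofReal_comp
  refine h.congr_deriv ?_
  push_cast
  ring

theorem hasDerivAt_freeJostPlus :
    HasDerivAt (freeJostPlus lam z) (freeJostPlusDeriv lam z x) x := by
  rw [funext (freeJostPlus_eq lam z)]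
  refine ((hasDerivAt_coshPow z x).mul
    (hasDerivAt_regularizedGaussHGFun_hgVar x _ _ _)).congr_deriv ?_
  rw [freeJostPlusDeriv]
  ring

/-- The free Jost solution solves `-y'' + lam / cosh² x · y = z² y`. -/
theorem hasDerivAt_freeJostPlusDeriv : HasDerivAt (freeJostPlusDeriv lam z)
    ((((lam / Real.cosh x ^ 2 : ℝ) : ℂ) - z ^ 2) * freeJostPlus lam z x) x := by
  have hv := (hasDerivAt_hgVar x).ofReal_comp
  have h1 := ((hv.const_mul 2).const_sub 1).const_mul (Complex.I * z)
  have h2 := (hv.const_mul 2).mul (hv.const_sub 1)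
  have hF := hasDerivAt_regularizedGaussHGFun_hgVar x (paramA lam z) (paramB lam z) (paramC z)
  have hF1 := hasDerivAt_regularizedGaussHGFun_hgVar x (paramA lam z + 1) (paramB lam z + 1)
    (paramC z + 1)
  have h := (hasDerivAt_coshPow z x).mul
    ((h1.mul hF).sub (h2.mul (hF1.const_mul (paramA lam z * paramB lam z))))
  refine h.congr_deriv ?_
  have hode := hypergeometric_equation (a := paramA lam z) (b := paramB lam z) (c := paramC z)
    (norm_hgVar_lt_one x)
  have hab := paramA_mul_paramB lam z
  have hs := paramA_add_paramB lam z
  rw [hs] at hode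
  rw [freeJostPlus_eq, div_eq_mul_one_div, one_div_cosh_sq]
  simp only [Pi.mul_apply, Pi.sub_apply]
  set F0 := regularizedGaussHGFun (paramA lam z) (paramB lam z) (paramC z) (hgVar x : ℂ)
  set F1 := regularizedGaussHGFun (paramA lam z + 1) (paramB lam z + 1) (paramC z + 1)
    (hgVar x : ℂ)
  set F2 := regularizedGaussHGFun (paramA lam z + 1 + 1) (paramB lam z + 1 + 1)
    (paramC z + 1 + 1) (hgVar x : ℂ)
  set ζ : ℂ := (hgVar x : ℂ)
  push_cast
  have hc : paramC z = 1 - Complex.I * z := rfl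
  rw [hc] at hode
  linear_combination (4 * ζ * (1 - ζ) * coshPow z x) * hode
    + (4 * ζ * (1 - ζ) * coshPow z x * F0) * hab
    + (coshPow z x * F0 * z ^ 2 * (1 - 2 * ζ) ^ 2) * Complex.I_sq

theorem isEntireOfOrderAtMostOne_freeJostPlus {x : ℝ} (hx : 2 ≤ x) :
    IsEntireOfOrderAtMostOne fun z => freeJostPlus lam z x := by
  have hζ : ‖(hgVar x : ℂ)‖ ≤ 1 / 16 := (norm_hgVar x).trans_le (hgVar_le hx)
  have h := isEntireOfOrderAtMostOne_regularizedGaussHGFun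
    (α := 1 / 2 + realSqrt (1 / 4 - lam)) (β := 1 / 2 - realSqrt (1 / 4 - lam)) (γ := 1) hζ
  convert (isEntireOfOrderAtMostOne_coshPow x).mul h using 3 with z
  rw [freeJostPlus_eq, paramA, paramB, paramC]
  ring_nf

theorem isEntireOfOrderAtMostOne_freeJostPlusDeriv {x : ℝ} (hx : 2 ≤ x) :
    IsEntireOfOrderAtMostOne fun z => freeJostPlusDeriv lam z x := by
  have hζ : ‖(hgVar x : ℂ)‖ ≤ 1 / 16 := (norm_hgVar x).trans_le (hgVar_le hx)
  have h := isEntireOfOrderAtMostOne_regularizedGaussHGFun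
    (α := 1 / 2 + realSqrt (1 / 4 - lam)) (β := 1 / 2 - realSqrt (1 / 4 - lam)) (γ := 1) hζ
  have h1 := isEntireOfOrderAtMostOne_regularizedGaussHGFun
    (α := 1 / 2 + realSqrt (1 / 4 - lam) + 1) (β := 1 / 2 - realSqrt (1 / 4 - lam) + 1)
    (γ := 1 + 1) hζ
  have hconst := fun c => isEntireOfOrderAtMostOne_const c
  have hid := isEntireOfOrderAtMostOne_id
  have hIz := (hconst Complex.I).mul hid
  have hab : IsEntireOfOrderAtMostOne fun z => paramA lam z * paramB lam z := by
    simp only [paramA_mul_paramB]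
    exact ((hconst lam).sub hIz).sub (hid.pow 2)
  have e1 : ∀ z, regularizedGaussHGFun (paramA lam z) (paramB lam z) (paramC z) (hgVar x : ℂ) =
      regularizedGaussHGFun (1 / 2 + realSqrt (1 / 4 - lam) - Complex.I * z)
        (1 / 2 - realSqrt (1 / 4 - lam) - Complex.I * z) (1 - Complex.I * z) (hgVar x : ℂ) := by
    intro z; rw [paramA, paramB, paramC]; ring_nf
  have e2 : ∀ z, regularizedGaussHGFun (paramA lam z + 1) (paramB lam z + 1) (paramC z + 1)
      (hgVar x : ℂ) = regularizedGaussHGFun (1 / 2 + realSqrt (1 / 4 - lam) + 1 - Complex.I * z)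
        (1 / 2 - realSqrt (1 / 4 - lam) + 1 - Complex.I * z) (1 + 1 - Complex.I * z)
        (hgVar x : ℂ) := by
    intro z; rw [paramA, paramB, paramC]; ring_nf
  simp only [freeJostPlusDeriv, e1, e2]
  exact (isEntireOfOrderAtMostOne_coshPow x).mul
    (((hIz.mul (hconst _)).mul h).sub ((hconst _).mul (hab.mul h1)))

end FreeSolution

/-! ### The Jost solutions -/

section

variable {lam : ℝ} {q : ℝ → ℝ}

theorem exists_forall_le_eq_zero_of_hasCompactSupport (hc : HasCompactSupport q) :
    ∃ X : ℝ, ∀ x, X ≤ |x| → q x = 0 := by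
  obtain ⟨R, hR⟩ := hc.isCompact.isBounded.subset_closedBall 0
  refine ⟨R + 1, fun x hx => ?_⟩
  by_contra h
  have := hR (subset_tsupport q h)
  rw [mem_closedBall_zero_iff, Real.norm_eq_abs] at this
  linarith

theorem primitiveAt_eq_of_le (hq : Integrable q) {X x : ℝ} (hX : ∀ t, X ≤ t → q t = 0)
    (hx : X ≤ x) : primitiveAt q x = primitiveAt q X := by
  have h : ∫ t in X..x, q t = 0 := intervalIntegral.integral_zero_ae
    (.of_forall fun t ht => hX t ((Set.uIoc_of_le hx ▸ ht).1.le))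
  rw [primitiveAt, primitiveAt, ← intervalIntegral.integral_add_adjacent_intervals
    (hq.intervalIntegrable (a := 0) (b := X)) hq.intervalIntegrable, h, add_zero]

/-- Growth in the spectral parameter of the solutions of the first order system. Grönwall's
inequality is applied to the rescaled vector `((1 + |z|) y, w)`, for which the system has norm
`O(1 + |z|)`; without the rescaling only order two would result. -/
theorem growthAtMostOne_isQuasiSolution (hq : Integrable q) {y w : ℂ → ℝ → ℂ} {x₀ : ℝ}
    (h : ∀ z, IsQuasiSolution lam q z (y z) (w z)) (hy : GrowthAtMostOne fun z => ‖y z x₀‖)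
    (hw : GrowthAtMostOne fun z => ‖w z x₀‖) (x : ℝ) :
    (GrowthAtMostOne fun z => ‖y z x‖) ∧ GrowthAtMostOne fun z => ‖w z x‖ := by
  obtain ⟨B, hB⟩ := (isCompact_uIcc (a := x₀) (b := x)).exists_bound_of_continuousOn
    (continuous_primitiveAt hq).continuousOn
  have hB0 : 0 ≤ B := (norm_nonneg _).trans (hB x Set.right_mem_uIcc)
  set K : ℝ := |lam| + B ^ 2 + B with hK
  have hK0 : 0 ≤ K := by positivity
  have main : ∀ z, ‖(((1 + ‖z‖ : ℝ) : ℂ) * y z x, w z x)‖ ≤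
      ‖(((1 + ‖z‖ : ℝ) : ℂ) * y z x₀, w z x₀)‖ * Real.exp ((K + (1 + ‖z‖)) * |x - x₀|) := by
    intro z
    set k : ℝ := 1 + ‖z‖ with hk
    have hk1 : 1 ≤ k := by linarith [norm_nonneg z]
    have hk0 : 0 < k := by linarith
    have hkn : ‖(k : ℂ)‖ = k := by rw [Complex.norm_real, Real.norm_eq_abs, abs_of_pos hk0]
    refine norm_le_mul_exp_of_norm_deriv_le (f := fun t => ((k : ℂ) * y z t, w z t))
      (fun t _ => ((h z t).1.const_mul (k : ℂ)).prodMk (h z t).2) fun t ht => ?_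
    have hQ := hB t ht
    set m := ‖((k : ℂ) * y z t, w z t)‖ with hm
    have hm0 : 0 ≤ m := norm_nonneg _
    have hm1 : k * ‖y z t‖ ≤ m := by
      have := norm_fst_le ((k : ℂ) * y z t, w z t)
      rwa [norm_mul, hkn] at this
    have hm2 : ‖w z t‖ ≤ m := norm_snd_le ((k : ℂ) * y z t, w z t)
    rw [Prod.norm_def]
    refine max_le ?_ ?_
    · rw [norm_mul, hkn]
      calc k * ‖primitiveAt q t * y z t + w z t‖ ≤ k * (B * ‖y z t‖ + ‖w z t‖) := by
            gcongr
            refine (norm_add_le _ _).trans ?_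
            rw [norm_mul]
            gcongr
        _ = B * (k * ‖y z t‖) + k * ‖w z t‖ := by ring
        _ ≤ B * m + k * m := by gcongr
        _ ≤ (K + k) * m := by rw [← add_mul]; gcongr; nlinarith [abs_nonneg lam]
    · have hc : ‖quasiCoeff lam q z t‖ ≤ |lam| + k ^ 2 + B ^ 2 := by
        refine (norm_sub_le _ _).trans (add_le_add ((norm_sub_le _ _).trans (add_le_add ?_ ?_)) ?_)
        · rw [Complex.norm_real, Real.norm_eq_abs, abs_div]
          refine div_le_self (abs_nonneg _) ?_
          rw [abs_of_pos (by positivity)]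
          exact one_le_pow₀ (Real.one_le_cosh t)
        · rw [norm_pow]; gcongr; linarith
        · rw [norm_pow]; gcongr
      have hy1 : ‖y z t‖ ≤ m / k := (le_div_iff₀' hk0).2 hm1
      calc ‖quasiCoeff lam q z t * y z t - primitiveAt q t * w z t‖
          ≤ (|lam| + k ^ 2 + B ^ 2) * (m / k) + B * m := by
            refine (norm_sub_le _ _).trans ?_
            rw [norm_mul, norm_mul]
            gcongr
        _ = ((|lam| + B ^ 2) * (1 / k) + k + B) * m := by field_simp; ring
        _ ≤ ((|lam| + B ^ 2) * 1 + k + B) * m := by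
            gcongr
            rw [div_le_one hk0]; exact hk1
        _ = (K + k) * m := by rw [hK]; ring
  have hgrow : GrowthAtMostOne fun z =>
      ((1 + ‖z‖) * ‖y z x₀‖ + ‖w z x₀‖) *
        (Real.exp (|x - x₀| * ‖z‖) * Real.exp ((K + 1) * |x - x₀|)) := by
    refine GrowthAtMostOne.mul (((((growthAtMostOne_const 1).add growthAtMostOne_norm).mul hy
      (fun z => by positivity) fun z => norm_nonneg _)).add hw)
      ((growthAtMostOne_exp _).mul (growthAtMostOne_const _) (fun z => by positivity)
        fun z => by positivity) (fun z => by positivity) fun z => by positivity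
  have hle : ∀ z, ‖(((1 + ‖z‖ : ℝ) : ℂ) * y z x, w z x)‖ ≤
      ((1 + ‖z‖) * ‖y z x₀‖ + ‖w z x₀‖) *
        (Real.exp (|x - x₀| * ‖z‖) * Real.exp ((K + 1) * |x - x₀|)) := by
    intro z
    refine (main z).trans ?_
    rw [← Real.exp_add]
    have e : (K + (1 + ‖z‖)) * |x - x₀| = |x - x₀| * ‖z‖ + (K + 1) * |x - x₀| := by ring
    have hn : ‖((1 + ‖z‖ : ℝ) : ℂ)‖ = 1 + ‖z‖ := by
      rw [Complex.norm_real, Real.norm_eq_abs, abs_of_pos (by positivity)]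
    rw [e]
    gcongr
    rw [Prod.norm_def, norm_mul, hn]
    exact max_le_add_of_nonneg (by positivity) (by positivity)
  refine ⟨hgrow.mono fun z => le_trans ?_ (hle z), hgrow.mono fun z =>
    le_trans (norm_snd_le (((1 + ‖z‖ : ℝ) : ℂ) * y z x, w z x)) (hle z)⟩
  refine le_trans ?_ (norm_fst_le (((1 + ‖z‖ : ℝ) : ℂ) * y z x, w z x))
  rw [norm_mul, Complex.norm_real, Real.norm_eq_abs, abs_of_pos (by positivity)]
  exact le_mul_of_one_le_left (norm_nonneg _) (by linarith [norm_nonneg z])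

/-- The Jost solutions at `+∞`, as a family depending holomorphically on `z`: the solutions with
the initial values of the free Jost solution at a point to the right of the support of `q`. -/
theorem exists_family_isJostPlus (lam : ℝ) (hq : Integrable q) (hc : HasCompactSupport q) :
    ∃ y : ℂ → ℝ → ℂ, (∀ z, IsJostPlus lam q z (y z)) ∧
      (∀ x, IsEntireOfOrderAtMostOne fun z => y z x) ∧
      ∀ x, IsEntireOfOrderAtMostOne fun z => deriv (y z) x := by
  obtain ⟨X₀, hX₀⟩ := exists_forall_le_eq_zero_of_hasCompactSupport hc
  -- `2 ≤ X` keeps the argument of the hypergeometric function below `1/16`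
  set X := max X₀ 2 with hX
  have hX2 : 2 ≤ X := le_max_right _ _
  have hqX : ∀ t, X ≤ t → q t = 0 := fun t ht =>
    hX₀ t ((le_max_left _ _).trans (ht.trans (le_abs_self t)))
  have h1 := isEntireOfOrderAtMostOne_freeJostPlus lam hX2
  have h2 := (isEntireOfOrderAtMostOne_freeJostPlusDeriv lam hX2).sub
    ((isEntireOfOrderAtMostOne_const (primitiveAt q X)).mul h1)
  obtain ⟨y, w, hy0, hw0, hyw, hyd, hwd⟩ := exists_isQuasiSolution (lam := lam) hq h1.1 h2.1 X
  have hgr := growthAtMostOne_isQuasiSolution hq hyw (x₀ := X)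
    (by simpa only [hy0] using (isEntireOfOrderAtMostOne_iff.1 h1).2)
    (by simpa only [hw0] using (isEntireOfOrderAtMostOne_iff.1 h2).2)
  have hye : ∀ x, IsEntireOfOrderAtMostOne fun z => y z x := fun x => ⟨hyd x, (hgr x).1⟩
  have hwe : ∀ x, IsEntireOfOrderAtMostOne fun z => w z x := fun x => ⟨hwd x, (hgr x).2⟩
  refine ⟨y, fun z => ⟨(hyw z).isSchrodingerSolution hq, ?_⟩, hye, fun x => ?_⟩
  · -- to the right of `X` the primitive of `q` is constant and the free Jost solution solves the
    -- perturbed system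
    filter_upwards [eventually_ge_atTop X] with x hx
    refine congrArg Prod.fst (eq_of_hasDerivAt_quasiMatrix (lam := lam) hq (z := z) (x₀ := X)
      (x := x) (u := fun t => (y z t, w z t)) (u₂ := fun t => (freeJostPlus lam z t,
        freeJostPlusDeriv lam z t - primitiveAt q X * freeJostPlus lam z t))
      (fun t _ => isQuasiSolution_iff.1 (hyw z) t) (fun t ht => ?_) ?_)
    · rw [Set.uIcc_of_le hx] at ht
      have hQ := primitiveAt_eq_of_le hq hqX ht.1
      have hf := hasDerivAt_freeJostPlus lam z t
      have hf' := hasDerivAt_freeJostPlusDeriv lam z t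
      rw [quasiMatrix_apply]
      refine (hf.congr_deriv ?_).prodMk ((hf'.sub (hf.const_mul _)).congr_deriv ?_)
      · simp only [hQ]; ring
      · simp only [quasiCoeff, hQ]; ring
    · simp only [hy0, hw0]
  · have : ∀ z, deriv (y z) x = primitiveAt q x * y z x + w z x := fun z => (hyw z x).1.deriv
    simp only [this]
    exact ((isEntireOfOrderAtMostOne_const _).mul (hye x)).add (hwe x)

theorem IsJostPlus.unique (hq : Integrable q) {z : ℂ} {y y₂ : ℝ → ℂ} (h : IsJostPlus lam q z y)
    (h₂ : IsJostPlus lam q z y₂) : y = y₂ := by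
  have he : y =ᶠ[atTop] y₂ := by filter_upwards [h.2, h₂.2] with x h1 h2 using h1.trans h2.symm
  obtain ⟨T, hT⟩ := eventually_atTop.1 he
  have hn : y =ᶠ[𝓝 (T + 1)] y₂ := by
    filter_upwards [Ioi_mem_nhds (lt_add_one T)] with x hx using hT x (Set.mem_Ioi.1 hx).le
  exact h.1.eq_of_eq_at hq h₂.1 hn.eq_of_nhds hn.deriv_eq

theorem isJostPlus_jostPlus (hq : Integrable q) (hc : HasCompactSupport q) (z : ℂ) :
    IsJostPlus lam q z (jostPlus lam q z) :=
  let ⟨y, hy, _⟩ := exists_family_isJostPlus lam hq hc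
  Classical.epsilon_spec ⟨y z, hy z⟩

theorem isEntireOfOrderAtMostOne_jostPlus (hq : Integrable q) (hc : HasCompactSupport q) (x : ℝ) :
    (IsEntireOfOrderAtMostOne fun z => jostPlus lam q z x) ∧
      IsEntireOfOrderAtMostOne fun z => deriv (jostPlus lam q z) x := by
  obtain ⟨y, hy, h1, h2⟩ := exists_family_isJostPlus lam hq hc
  have : ∀ z, jostPlus lam q z = y z := fun z => (isJostPlus_jostPlus hq hc z).unique hq (hy z)
  simp only [this]
  exact ⟨h1 x, h2 x⟩

section Reflection

theorem deriv_comp_neg_eq (y : ℝ → ℂ) (x : ℝ) : deriv (fun t => y (-t)) x = -deriv y (-x) := by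
  rw [deriv_comp_neg (f := y)]

theorem IsSchrodingerSolution.comp_neg {z : ℂ} {y : ℝ → ℂ}
    (h : IsSchrodingerSolution (potential lam q) z y) :
    IsSchrodingerSolution (potential lam fun x => q (-x)) z fun x => y (-x) := by
  refine ⟨h.1.comp contDiff_neg, fun s t => ?_⟩
  rw [deriv_comp_neg_eq, deriv_comp_neg_eq]
  have h1 := h.2 (-t) (-s)
  rw [← intervalIntegral.integral_comp_neg (fun x => ((potential lam q x : ℂ) - z ^ 2) * y x)] at h1
  calc -deriv y (-t) - -deriv y (-s) = deriv y (-s) - deriv y (-t) := by ring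
    _ = _ := h1
    _ = _ := by simp only [potential, Real.cosh_neg]

/-- The reflection `x ↦ -x` exchanges the two Jost solutions and replaces `q(x)` by `q(-x)`. -/
theorem isJostMinus_iff {z : ℂ} {y : ℝ → ℂ} :
    IsJostMinus lam q z y ↔ IsJostPlus lam (fun x => q (-x)) z fun x => y (-x) := by
  have hev : (∀ᶠ x in atBot, y x = freeJostMinus lam z x) ↔
      ∀ᶠ x in atTop, y (-x) = freeJostPlus lam z x := by
    rw [← map_neg_atTop, eventually_map]
    simp only [freeJostMinus_eq, neg_neg]
  refine and_congr ⟨fun h => h.comp_neg, fun h => ?_⟩ hev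
  simpa only [neg_neg] using h.comp_neg

theorem IsJostMinus.unique (hq : Integrable q) {z : ℂ} {y y₂ : ℝ → ℂ} (h : IsJostMinus lam q z y)
    (h₂ : IsJostMinus lam q z y₂) : y = y₂ := by
  have := (isJostMinus_iff.1 h).unique hq.comp_neg (isJostMinus_iff.1 h₂)
  funext x
  simpa using congrFun this (-x)

theorem hasCompactSupport_comp_neg (hc : HasCompactSupport q) :
    HasCompactSupport fun x => q (-x) :=
  hc.comp_homeomorph (Homeomorph.neg ℝ)

theorem isJostMinus_comp_neg (hq : Integrable q) (hc : HasCompactSupport q) (z : ℂ) :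
    IsJostMinus lam q z fun x => jostPlus lam (fun x => q (-x)) z (-x) := by
  rw [isJostMinus_iff]
  simpa only [neg_neg] using isJostPlus_jostPlus hq.comp_neg (hasCompactSupport_comp_neg hc) z

theorem isJostMinus_jostMinus (hq : Integrable q) (hc : HasCompactSupport q) (z : ℂ) :
    IsJostMinus lam q z (jostMinus lam q z) :=
  Classical.epsilon_spec ⟨_, isJostMinus_comp_neg hq hc z⟩

theorem jostMinus_eq (hq : Integrable q) (hc : HasCompactSupport q) (z : ℂ) :
    jostMinus lam q z = fun x => jostPlus lam (fun x => q (-x)) z (-x) :=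
  (isJostMinus_jostMinus hq hc z).unique hq (isJostMinus_comp_neg hq hc z)

theorem isEntireOfOrderAtMostOne_jostMinus (hq : Integrable q) (hc : HasCompactSupport q)
    (x : ℝ) : (IsEntireOfOrderAtMostOne fun z => jostMinus lam q z x) ∧
      IsEntireOfOrderAtMostOne fun z => deriv (jostMinus lam q z) x := by
  have h := isEntireOfOrderAtMostOne_jostPlus (lam := lam) hq.comp_neg
    (hasCompactSupport_comp_neg hc) (-x)
  simp only [jostMinus_eq hq hc, deriv_comp_neg_eq]
  refine ⟨h.1, ?_⟩
  simpa using (isEntireOfOrderAtMostOne_const 0).sub h.2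

end Reflection

theorem wronskian_jostMinus_jostPlus (hq : Integrable q) (hc : HasCompactSupport q) (z : ℂ)
    (x : ℝ) : wronskian (jostMinus lam q z) (jostPlus lam q z) x = jostW lam q z :=
  wronskian_eq_wronskian hq rfl (isJostMinus_jostMinus hq hc z).1
    (isJostPlus_jostPlus hq hc z).1 _ _

theorem isEntireOfOrderAtMostOne_jostW (hq : Integrable q) (hc : HasCompactSupport q) :
    IsEntireOfOrderAtMostOne (jostW lam q) := by
  have hp := isEntireOfOrderAtMostOne_jostPlus (lam := lam) hq hc 0
  have hm := isEntireOfOrderAtMostOne_jostMinus (lam := lam) hq hc 0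
  exact (hm.1.mul hp.2).sub (hm.2.mul hp.1)

theorem differentiable_jostSPlus (hq : Integrable q) (hc : HasCompactSupport q) :
    Differentiable ℂ (jostSPlus lam q) := by
  have hp := isEntireOfOrderAtMostOne_jostPlus (lam := lam) hq hc 0
  have hm := isEntireOfOrderAtMostOne_jostMinus (lam := lam) hq hc 0
  exact ((hp.1.1.comp differentiable_neg).mul hm.2.1).sub
    ((hp.2.1.comp differentiable_neg).mul hm.1.1)

theorem differentiable_jostSMinus (hq : Integrable q) (hc : HasCompactSupport q) :
    Differentiable ℂ (jostSMinus lam q) := by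
  have hp := isEntireOfOrderAtMostOne_jostPlus (lam := lam) hq hc 0
  have hm := isEntireOfOrderAtMostOne_jostMinus (lam := lam) hq hc 0
  exact (hp.1.1.mul (hm.2.1.comp differentiable_neg)).sub
    (hp.2.1.mul (hm.1.1.comp differentiable_neg))

end

/-! ### Zeros of the Jost function and poles of the reflection coefficients -/

section

open Complex (regularizedGaussHGFun)

variable {lam : ℝ} {q : ℝ → ℝ}

theorem IsJostPlus.eventually_eq {z : ℂ} {y : ℝ → ℂ} (h : IsJostPlus lam q z y) :
    ∀ᶠ x in atTop, y x = freeJostPlus lam z x ∧ deriv y x = freeJostPlusDeriv lam z x := by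
  obtain ⟨T, hT⟩ := eventually_atTop.1 h.2
  filter_upwards [eventually_gt_atTop T] with x hx
  have hn : y =ᶠ[𝓝 x] freeJostPlus lam z := by
    filter_upwards [Ioi_mem_nhds hx] with t ht using hT t (Set.mem_Ioi.1 ht).le
  exact ⟨hn.eq_of_nhds, hn.deriv_eq.trans (hasDerivAt_freeJostPlus lam z x).deriv⟩

theorem tendsto_regularizedGaussHGFun_hgVar (a b c : ℂ) :
    Tendsto (fun x => regularizedGaussHGFun a b c (hgVar x : ℂ)) atTop
      (𝓝 (Complex.Gamma c)⁻¹) := by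
  rw [← regularizedGaussHGFun_zero a b c]
  have hc := (hasDerivAt_regularizedGaussHGFun (a := a) (b := b) (c := c) (ζ := 0)
    (by simp)).continuousAt
  have hv : Tendsto (fun x => (hgVar x : ℂ)) atTop (𝓝 0) := by
    simpa [Function.comp_def] using (Complex.continuous_ofReal.tendsto 0).comp tendsto_hgVar
  exact hc.tendsto.comp hv

/-- The quotient of the derivative of the free Jost solution by its prefactor tends to
`i z / Γ(1 - i z)`. -/
theorem tendsto_freeJostPlusDeriv_factor (lam : ℝ) (z : ℂ) :
    Tendsto (fun x => Complex.I * z * (1 - 2 * hgVar x) *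
      regularizedGaussHGFun (paramA lam z) (paramB lam z) (paramC z) (hgVar x : ℂ) -
      2 * hgVar x * (1 - hgVar x) * (paramA lam z * paramB lam z *
      regularizedGaussHGFun (paramA lam z + 1) (paramB lam z + 1) (paramC z + 1) (hgVar x : ℂ)))
      atTop (𝓝 (Complex.I * z * (Complex.Gamma (paramC z))⁻¹)) := by
  have hv : Tendsto (fun x => (hgVar x : ℂ)) atTop (𝓝 0) := by
    simpa [Function.comp_def] using (Complex.continuous_ofReal.tendsto 0).comp tendsto_hgVar
  have h := (((hv.const_mul 2).const_sub 1).const_mul (Complex.I * z)).mul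
    (tendsto_regularizedGaussHGFun_hgVar (paramA lam z) (paramB lam z) (paramC z)) |>.sub
    (((hv.const_mul 2).mul (hv.const_sub 1)).mul
      ((tendsto_regularizedGaussHGFun_hgVar (paramA lam z + 1) (paramB lam z + 1)
        (paramC z + 1)).const_mul (paramA lam z * paramB lam z)))
  simpa using h

/-- The Wronskian of the Jost solutions at `z` and `-z`, read off at infinity. -/
theorem IsJostPlus.wronskian_neg (hq : Integrable q) {z : ℂ} {y y₂ : ℝ → ℂ}
    (h : IsJostPlus lam q z y) (h₂ : IsJostPlus lam q (-z) y₂) (x : ℝ) :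
    wronskian y y₂ x = -2 * Complex.I * z *
      ((Complex.Gamma (paramC z))⁻¹ * (Complex.Gamma (paramC (-z)))⁻¹) := by
  have hlim := ((tendsto_regularizedGaussHGFun_hgVar (paramA lam z) (paramB lam z)
    (paramC z)).mul (tendsto_freeJostPlusDeriv_factor lam (-z))).sub
    ((tendsto_freeJostPlusDeriv_factor lam z).mul
    (tendsto_regularizedGaussHGFun_hgVar (paramA lam (-z)) (paramB lam (-z)) (paramC (-z))))
  have hconst : Tendsto (wronskian y y₂) atTop (𝓝 (wronskian y y₂ x)) :=
    tendsto_const_nhds.congr fun t => wronskian_eq_wronskian hq (by ring) h.1 h₂.1 x t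
  refine tendsto_nhds_unique hconst (Tendsto.congr' ?_ (hlim.trans_eq ?_))
  · filter_upwards [h.eventually_eq, h₂.eventually_eq] with t ht ht₂
    rw [wronskian, ht.1, ht.2, ht₂.1, ht₂.2, freeJostPlus_eq, freeJostPlus_eq,
      freeJostPlusDeriv, freeJostPlusDeriv]
    have hg := coshPow_neg_mul z t
    generalize coshPow z t = g at *
    generalize coshPow (-z) t = g' at *
    generalize regularizedGaussHGFun (paramA lam z) (paramB lam z) (paramC z) (hgVar t : ℂ) = F
    generalize regularizedGaussHGFun (paramA lam (-z)) (paramB lam (-z)) (paramC (-z))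
      (hgVar t : ℂ) = F'
    generalize Complex.I * z * (1 - 2 * hgVar t) * F - _ = D
    generalize Complex.I * -z * (1 - 2 * hgVar t) * F' - _ = D'
    linear_combination -(F * D' - D * F') * hg
  · congr 1; ring

/-- Mathlib's `Γ` vanishes at its poles, where `1 - i z` is a non-positive integer. -/
theorem Gamma_paramC_ne_zero {z : ℂ} (hz : ∀ k : ℤ, z ≠ Complex.I * (k : ℂ)) :
    Complex.Gamma (paramC z) ≠ 0 := by
  refine Complex.Gamma_ne_zero fun m hm => hz (-(m + 1)) ?_
  simp only [paramC] at hm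
  push_cast
  linear_combination Complex.I * hm + z * Complex.I_sq

theorem IsJostPlus.wronskian_neg_ne_zero (hq : Integrable q) {z : ℂ} {y y₂ : ℝ → ℂ}
    (hz : ∀ k : ℤ, z ≠ Complex.I * (k : ℂ))
    (h : IsJostPlus lam q z y) (h₂ : IsJostPlus lam q (-z) y₂) (x : ℝ) :
    wronskian y y₂ x ≠ 0 := by
  have hz0 : z ≠ 0 := by simpa using hz 0
  have hz' : ∀ k : ℤ, -z ≠ Complex.I * (k : ℂ) := fun k hk => hz (-k) (by
    push_cast; rw [mul_neg, ← hk, neg_neg])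
  rw [h.wronskian_neg hq h₂]
  have h1 := inv_ne_zero (Gamma_paramC_ne_zero hz)
  have h2 := inv_ne_zero (Gamma_paramC_ne_zero hz')
  have := Complex.I_ne_zero
  simp [*]

theorem wronskian_comp_neg (y y₂ : ℝ → ℂ) (x : ℝ) :
    wronskian (fun t => y (-t)) (fun t => y₂ (-t)) x = -wronskian y y₂ (-x) := by
  simp only [wronskian, deriv_comp_neg_eq]; ring

theorem IsJostMinus.wronskian_neg_ne_zero (hq : Integrable q) {z : ℂ} {y y₂ : ℝ → ℂ}
    (hz : ∀ k : ℤ, z ≠ Complex.I * (k : ℂ))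
    (h : IsJostMinus lam q z y) (h₂ : IsJostMinus lam q (-z) y₂) (x : ℝ) :
    wronskian y y₂ x ≠ 0 := by
  have := (isJostMinus_iff.1 h).wronskian_neg_ne_zero hq.comp_neg hz (isJostMinus_iff.1 h₂) (-x)
  rwa [wronskian_comp_neg, neg_neg, neg_ne_zero] at this

/-- If `W(z) = 0`, the Jost solution at `-∞` is proportional to the one at `+∞`; since the latter
is independent of the Jost solution at `-z`, the function `S⁺` cannot vanish at `z`. -/
theorem jostSPlus_ne_zero (hq : Integrable q) (hc : HasCompactSupport q) {z : ℂ}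
    (hz : ∀ k : ℤ, z ≠ Complex.I * (k : ℂ)) (hW : jostW lam q z = 0) : jostSPlus lam q z ≠ 0 := by
  intro hS
  have h1 := (isJostPlus_jostPlus (lam := lam) hq hc z).wronskian_neg_ne_zero hq hz
    (isJostPlus_jostPlus hq hc (-z)) 0
  have h2 := (isJostMinus_jostMinus (lam := lam) hq hc z).wronskian_neg_ne_zero hq hz
    (isJostMinus_jostMinus hq hc (-z)) 0
  simp only [jostW, jostSPlus, wronskian] at hW hS h1 h2
  have e1 : jostMinus lam q z 0 = 0 := by
    refine (mul_eq_zero.1 ?_).resolve_right h1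
    linear_combination -jostPlus lam q (-z) 0 * hW - jostPlus lam q z 0 * hS
  have e2 : deriv (jostMinus lam q z) 0 = 0 := by
    refine (mul_eq_zero.1 ?_).resolve_right h1
    linear_combination -deriv (jostPlus lam q (-z)) 0 * hW - deriv (jostPlus lam q z) 0 * hS
  exact h2 (by rw [e1, e2]; ring)

/-- The counterpart of `jostSPlus_ne_zero`, with the two ends exchanged. -/
theorem jostSMinus_ne_zero (hq : Integrable q) (hc : HasCompactSupport q) {z : ℂ}
    (hz : ∀ k : ℤ, z ≠ Complex.I * (k : ℂ)) (hW : jostW lam q z = 0) : jostSMinus lam q z ≠ 0 := by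
  intro hS
  have h1 := (isJostPlus_jostPlus (lam := lam) hq hc z).wronskian_neg_ne_zero hq hz
    (isJostPlus_jostPlus hq hc (-z)) 0
  have h2 := (isJostMinus_jostMinus (lam := lam) hq hc z).wronskian_neg_ne_zero hq hz
    (isJostMinus_jostMinus hq hc (-z)) 0
  simp only [jostW, jostSMinus, wronskian] at hW hS h1 h2
  have e1 : jostPlus lam q z 0 = 0 := by
    refine (mul_eq_zero.1 ?_).resolve_right h2
    linear_combination jostMinus lam q (-z) 0 * hW + jostMinus lam q z 0 * hS
  have e2 : deriv (jostPlus lam q z) 0 = 0 := by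
    refine (mul_eq_zero.1 ?_).resolve_right h2
    linear_combination deriv (jostMinus lam q (-z)) 0 * hW + deriv (jostMinus lam q z) 0 * hS
  exact h1 (by rw [e1, e2]; ring)

/-- If `S` and `W` have no common zero, the zeros of `W` are the poles of `S / W`. An identically
vanishing `W` is excluded on both sides: its order is `⊤`, and so is that of `S / 0 = 0`. -/
theorem analyticOrderAt_eq_iff_meromorphicOrderAt_div_eq {S W : ℂ → ℂ} {z : ℂ}
    (hS : AnalyticAt ℂ S z) (hW : AnalyticAt ℂ W z) (h : W z = 0 → S z ≠ 0) {n : ℕ} (hn : 0 < n) :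
    analyticOrderAt W z = (n : ℕ∞) ↔
      meromorphicOrderAt (fun w => S w / W w) z = ((-(n : ℤ) : ℤ) : WithTop ℤ) := by
  have e : meromorphicOrderAt (fun w => S w / W w) z =
      meromorphicOrderAt S z - meromorphicOrderAt W z :=
    meromorphicOrderAt_div hS.meromorphicAt hW.meromorphicAt
  rw [e, hS.meromorphicOrderAt_eq, hW.meromorphicOrderAt_eq]
  by_cases hz : W z = 0
  · rw [hS.analyticOrderAt_eq_zero.2 (h hz)]
    cases analyticOrderAt W z with
    | top =>
      refine iff_of_false (ENat.top_ne_natCast n) ?_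
      exact (WithTop.coe_ne_top (a := (-(n : ℤ)))).symm
    | coe m =>
      have e2 : (ENat.map (fun k : ℕ => (k : ℤ)) 0 : WithTop ℤ) -
          ENat.map (fun k : ℕ => (k : ℤ)) (m : ℕ∞) = ((-(m : ℤ) : ℤ) : WithTop ℤ) := by
        simp
      rw [e2, Nat.cast_inj, WithTop.coe_inj]
      omega
  · rw [hW.analyticOrderAt_eq_zero.2 hz]
    have h0 : (0 : ℕ∞) ≠ n := by exact_mod_cast hn.ne
    refine iff_of_false h0 ?_
    cases analyticOrderAt S z with
    | top => exact (WithTop.coe_ne_top (a := (-(n : ℤ)))).symm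
    | coe m =>
      have e2 : (ENat.map (fun k : ℕ => (k : ℤ)) (m : ℕ∞) : WithTop ℤ) -
          ENat.map (fun k : ℕ => (k : ℤ)) 0 = ((m : ℤ) : WithTop ℤ) := by
        simp
      rw [e2, WithTop.coe_inj]
      omega

end

/-! ### High-energy asymptotics on the imaginary axis -/

section

variable {lam : ℝ} {q : ℝ → ℝ}

theorem integrable_potential (hq : Integrable q) : Integrable (potential lam q) := by
  have h1 : Integrable fun x => lam / Real.cosh x ^ 2 := by
    refine (integrable_inv_one_add_sq.const_mul |lam|).mono'
      (Continuous.aestronglyMeasurable (continuous_const.div (by fun_prop)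
        fun x => by positivity)) (.of_forall fun x => ?_)
    have hs : x ^ 2 ≤ Real.sinh x ^ 2 := by
      rw [← sq_abs x, ← sq_abs (Real.sinh x), Real.abs_sinh]
      exact pow_le_pow_left₀ (abs_nonneg x) (Real.self_le_sinh_iff.2 (abs_nonneg x)) 2
    rw [norm_div, Real.norm_eq_abs, Real.norm_eq_abs,
      abs_of_pos (by positivity : 0 < Real.cosh x ^ 2), Real.cosh_sq, div_eq_mul_inv]
    exact mul_le_mul_of_nonneg_left (inv_anti₀ (by positivity) (by linarith)) (abs_nonneg _)
  exact h1.add hq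

/-- For `z² = -k²`, the function `e^{kx} (y' - k y)` built from a solution `y` is a primitive of
`e^{kx} V y`. -/
theorem IsSchrodingerSolution.exp_mul_sub_eq_integral (hq : Integrable q) {z k : ℂ} {y : ℝ → ℂ}
    (hz : z ^ 2 = -k ^ 2) (h : IsSchrodingerSolution (potential lam q) z y) (s t : ℝ) :
    Complex.exp (k * t) * (deriv y t - k * y t) - Complex.exp (k * s) * (deriv y s - k * y s) =
      ∫ x in s..t, Complex.exp (k * x) * ((potential lam q x : ℂ) * y x) := by
  set w : ℝ → ℂ := fun x => deriv y x - primitiveAt q x * y x with hw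
  have hqs : IsQuasiSolution lam q z y w := h.isQuasiSolution hq
  have hyc := h.1.continuous
  have hyd : Continuous (deriv y) := h.1.continuous_deriv le_rfl
  have hQ := continuous_primitiveAt hq
  have hwc : Continuous w := hyd.sub (hQ.mul hyc)
  have hcc := (continuous_uncurry_quasiCoeff (lam := lam) hq).comp (Continuous.prodMk_left z)
  have hy : ∀ x, HasDerivAt y (deriv y x) x := fun x =>
    (h.1.differentiable one_ne_zero x).hasDerivAt
  have he : ∀ x : ℝ, HasDerivAt (fun x : ℝ => Complex.exp (k * x)) (k * Complex.exp (k * x)) x := by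
    intro x
    refine ((Complex.ofRealCLM.hasDerivAt (x := x)).const_mul k).cexp.congr_deriv ?_
    simp; ring
  have hec : Continuous fun x : ℝ => Complex.exp (k * x) := by fun_prop
  -- the two parts `Q e y` and `e (w - k y)` of `e (y' - k y)`
  have hd1 : ∀ x : ℝ, HasDerivAt (fun x : ℝ => Complex.exp (k * x) * y x)
      (k * Complex.exp (k * x) * y x + Complex.exp (k * x) * deriv y x) x :=
    fun x => (he x).mul (hy x)
  have hc1 : Continuous fun x : ℝ =>
      k * Complex.exp (k * x) * y x + Complex.exp (k * x) * deriv y x := by fun_prop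
  have hd2 : ∀ x : ℝ, HasDerivAt (fun x : ℝ => Complex.exp (k * x) * (w x - k * y x))
      (k * Complex.exp (k * x) * (w x - k * y x) + Complex.exp (k * x) *
        ((quasiCoeff lam q z x * y x - primitiveAt q x * w x) - k * deriv y x)) x :=
    fun x => (he x).mul ((hqs x).2.sub ((hy x).const_mul k))
  have hc2 : Continuous fun x : ℝ => k * Complex.exp (k * x) * (w x - k * y x) +
      Complex.exp (k * x) *
        ((quasiCoeff lam q z x * y x - primitiveAt q x * w x) - k * deriv y x) :=
    ((continuous_const.mul hec).mul (hwc.sub (continuous_const.mul hyc))).add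
      (hec.mul (((hcc.mul hyc).sub (hQ.mul hwc)).sub (continuous_const.mul hyd)))
  have h1 := integral_mul_add_primitiveAt_mul hq hd1 hc1 s t
  have h2 := intervalIntegral.integral_eq_sub_of_hasDerivAt (a := s) (b := t)
    (fun x _ => hd2 x) (hc2.intervalIntegrable _ _)
  have hi : IntervalIntegrable (fun x => (q x : ℂ) * (Complex.exp (k * x) * y x) +
      primitiveAt q x * (k * Complex.exp (k * x) * y x + Complex.exp (k * x) * deriv y x))
      volume s t :=
    (hq.ofReal.intervalIntegrable.mul_continuousOn (hec.mul hyc).continuousOn).add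
      ((hQ.mul hc1).intervalIntegrable _ _)
  have e0 : Complex.exp (k * t) * (deriv y t - k * y t) -
      Complex.exp (k * s) * (deriv y s - k * y s) =
      (primitiveAt q t * (Complex.exp (k * t) * y t) -
        primitiveAt q s * (Complex.exp (k * s) * y s)) +
      (Complex.exp (k * t) * (w t - k * y t) - Complex.exp (k * s) * (w s - k * y s)) := by
    simp only [hw]; ring
  rw [e0, ← h1, ← h2, ← intervalIntegral.integral_add hi (hc2.intervalIntegrable _ _)]
  refine intervalIntegral.integral_congr fun x _ => ?_
  simp only [quasiCoeff, potential, hz, hw]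
  push_cast
  ring

/-- The prefactor `(2 cosh x)^{-κ}` is asymptotic to `e^{-κx}`. -/
theorem tendsto_exp_mul_coshPow (κ : ℝ) :
    Tendsto (fun x : ℝ => Complex.exp (κ * x) * coshPow (Complex.I * κ) x) atTop (𝓝 1) := by
  have h : ∀ x : ℝ, Complex.exp (κ * x) * coshPow (Complex.I * κ) x =
      ((Real.exp (κ * Real.log (1 - hgVar x)) : ℝ) : ℂ) := by
    intro x
    have h0 : (0 : ℝ) < 2 * Real.cosh x := by positivity
    have h1 : 1 - hgVar x = Real.exp x / (2 * Real.cosh x) := by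
      have hx : Real.exp (2 * x) = Real.exp x ^ 2 := by rw [← Real.exp_nat_mul]; norm_num
      have hp := Real.exp_pos x
      rw [hgVar, Real.cosh_eq, Real.exp_neg, hx]
      field_simp
      ring
    rw [h1, Real.log_div (Real.exp_pos x).ne' h0.ne', Real.log_exp, coshPow_eq, ← Complex.exp_add,
      Complex.ofReal_exp]
    congr 1
    push_cast
    linear_combination (Real.log (2 * Real.cosh x) * κ : ℂ) * Complex.I_sq
  have h2 : Tendsto (fun x => Real.exp (κ * Real.log (1 - hgVar x))) atTop (𝓝 1) := by
    have h3 := ((tendsto_hgVar.const_sub 1).log (by norm_num)).const_mul κ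
    simpa [Function.comp_def] using (Real.continuous_exp.tendsto _).comp h3
  simp only [h]
  simpa [Function.comp_def] using (Complex.continuous_ofReal.tendsto 1).comp h2

/-- The unnormalised Jost solution at `z = iκ` is asymptotic to `e^{-κx}`, together with its
derivative. -/
theorem IsJostPlus.tendsto_exp_mul {κ : ℝ} (hκ : 0 < κ) {y : ℝ → ℂ}
    (h : IsJostPlus lam q (Complex.I * κ) y) :
    Tendsto (fun x : ℝ => Complex.exp (κ * x) * (Complex.Gamma (1 + κ) * y x)) atTop (𝓝 1) ∧
    Tendsto (fun x : ℝ => Complex.exp (κ * x) * (Complex.Gamma (1 + κ) * deriv y x)) atTop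
      (𝓝 (-κ)) := by
  have hc : paramC (Complex.I * κ) = 1 + κ := by
    rw [paramC]; linear_combination (-κ : ℂ) * Complex.I_sq
  have hG : Complex.Gamma (1 + κ) ≠ 0 := by
    refine Complex.Gamma_ne_zero_of_re_pos ?_
    simp; linarith
  have h1 := (tendsto_exp_mul_coshPow κ).mul ((tendsto_regularizedGaussHGFun_hgVar
    (paramA lam (Complex.I * κ)) (paramB lam (Complex.I * κ))
    (paramC (Complex.I * κ))).const_mul (Complex.Gamma (1 + κ)))
  have h2 := (tendsto_exp_mul_coshPow κ).mul ((tendsto_freeJostPlusDeriv_factor lam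
    (Complex.I * κ)).const_mul (Complex.Gamma (1 + κ)))
  rw [hc] at h1 h2
  constructor
  · refine Tendsto.congr' ?_ (h1.trans_eq ?_)
    · filter_upwards [h.eventually_eq] with x hx
      rw [hx.1, freeJostPlus_eq, hc]; ring
    · rw [mul_inv_cancel₀ hG, mul_one]
  · refine Tendsto.congr' ?_ (h2.trans_eq ?_)
    · filter_upwards [h.eventually_eq] with x hx
      rw [hx.2, freeJostPlusDeriv, hc]; ring
    · congr 1
      field_simp
      linear_combination (κ : ℂ) * Complex.I_sq

/-- High-energy estimates on the half-line for a solution `f` asymptotic to `e^{-κx}`: a bound `M`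
for `e^{κx} f` controls `e^{κx} (f' - κ f)` and `e^{κx} (f' + κ f)`, since `e^{κx} (f' - κ f)` is a
primitive of `e^{κx} V f` with limit `-2κ` at infinity, and `e^{-κx} (f' + κ f)` one of
`e^{-κx} V f` with limit `0`. -/
theorem norm_exp_mul_sub_le (hq : Integrable q) {κ : ℝ} (hκ : 0 < κ) {f : ℝ → ℂ}
    (h : IsSchrodingerSolution (potential lam q) (Complex.I * κ) f)
    (h1 : Tendsto (fun x : ℝ => Complex.exp (κ * x) * f x) atTop (𝓝 1))
    (h2 : Tendsto (fun x : ℝ => Complex.exp (κ * x) * deriv f x) atTop (𝓝 (-κ))) {M : ℝ}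
    (hM : ∀ x : ℝ, 0 ≤ x → ‖Complex.exp (κ * x) * f x‖ ≤ M) {x : ℝ} (hx : 0 ≤ x) :
    ‖Complex.exp (κ * x) * (deriv f x - κ * f x) + 2 * κ‖ ≤ M * ∫ x, ‖potential lam q x‖ ∧
    ‖Complex.exp (κ * x) * (deriv f x + κ * f x)‖ ≤ M * ∫ x, ‖potential lam q x‖ := by
  have hM0 : 0 ≤ M := (norm_nonneg _).trans (hM 0 le_rfl)
  have hV := integrable_potential (lam := lam) hq
  have hnexp : ∀ r : ℝ, ‖Complex.exp (r : ℂ)‖ = Real.exp r := fun r => by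
    rw [← Complex.ofReal_exp, Complex.norm_real, Real.norm_eq_abs, Real.abs_exp]
  -- the integral over `[x, T]` of a function dominated by `D |V|`
  have hint : ∀ (D T : ℝ) (F : ℝ → ℂ), 0 ≤ D → x ≤ T →
      (∀ t, x ≤ t → ‖F t‖ ≤ D * ‖potential lam q t‖) →
      ‖∫ t in x..T, F t‖ ≤ D * ∫ x, ‖potential lam q x‖ := by
    intro D T F hD hT hF
    rw [← integral_const_mul]
    calc ‖∫ t in x..T, F t‖ ≤ ∫ t in x..T, D * ‖potential lam q t‖ :=
          intervalIntegral.norm_integral_le_of_norm_le hT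
            (.of_forall fun t ht => hF t ht.1.le) (hV.norm.const_mul D).intervalIntegrable
      _ = ∫ t in Set.Ioc x T, D * ‖potential lam q t‖ := intervalIntegral.integral_of_le hT
      _ ≤ ∫ t, D * ‖potential lam q t‖ :=
          setIntegral_le_integral (hV.norm.const_mul D) (.of_forall fun t => by positivity)
  have hzk : (Complex.I * κ) ^ 2 = -(κ : ℂ) ^ 2 := by
    linear_combination (κ : ℂ) ^ 2 * Complex.I_sq
  constructor
  · have hlim : Tendsto (fun T : ℝ => ‖Complex.exp (κ * x) * (deriv f x - κ * f x) -
        Complex.exp (κ * T) * (deriv f T - κ * f T)‖) atTop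
        (𝓝 ‖Complex.exp (κ * x) * (deriv f x - κ * f x) + 2 * κ‖) := by
      have := (tendsto_const_nhds (x := Complex.exp (κ * x) * (deriv f x - κ * f x))).sub
        (h2.sub (h1.const_mul (κ : ℂ)))
      refine (this.congr fun T => ?_).norm.trans_eq ?_
      · ring
      · congr 2; ring
    refine le_of_tendsto hlim ?_
    filter_upwards [eventually_ge_atTop x] with T hT
    rw [norm_sub_rev, h.exp_mul_sub_eq_integral hq hzk]
    refine hint M T _ hM0 hT fun t ht => ?_
    have := hM t (hx.trans ht)
    rw [mul_left_comm, norm_mul, Complex.norm_real, mul_comm]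
    gcongr
  · have hzk' : (Complex.I * κ) ^ 2 = -(-(κ : ℂ)) ^ 2 := by rw [hzk]; ring
    -- the same with `κ` replaced by `-κ`, where the boundary term at infinity vanishes
    have hdec : Tendsto (fun T : ℝ => Complex.exp (-2 * κ * T)) atTop (𝓝 0) := by
      rw [tendsto_zero_iff_norm_tendsto_zero]
      have : ∀ T : ℝ, ‖Complex.exp (-2 * κ * T)‖ = Real.exp (-(2 * κ * T)) := fun T => by
        rw [← hnexp]; push_cast; ring_nf
      simp only [this]
      exact Real.tendsto_exp_neg_atTop_nhds_zero.comp (tendsto_id.const_mul_atTop (by positivity))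
    have hsplit : ∀ T : ℝ, Complex.exp (-κ * T) =
        Complex.exp (-2 * κ * T) * Complex.exp (κ * T) := fun T => by
      rw [← Complex.exp_add]; ring_nf
    have hlim : Tendsto (fun T : ℝ => ‖Complex.exp (-κ * x) * (deriv f x - -κ * f x) -
        Complex.exp (-κ * T) * (deriv f T - -κ * f T)‖) atTop
        (𝓝 ‖Complex.exp (-κ * x) * (deriv f x - -κ * f x)‖) := by
      have := (tendsto_const_nhds (x := Complex.exp (-κ * x) * (deriv f x - -κ * f x))).sub
        (hdec.mul (h2.add (h1.const_mul (κ : ℂ))))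
      refine (this.congr fun T => ?_).norm.trans_eq ?_
      · rw [hsplit T]; ring
      · simp
    have hle : ‖Complex.exp (-κ * x) * (deriv f x - -κ * f x)‖ ≤
        M * Real.exp (-(2 * κ * x)) * ∫ x, ‖potential lam q x‖ := by
      refine le_of_tendsto hlim ?_
      filter_upwards [eventually_ge_atTop x] with T hT
      rw [norm_sub_rev, h.exp_mul_sub_eq_integral hq hzk']
      refine hint _ T _ (by positivity) hT fun t ht => ?_
      have := hM t (hx.trans ht)
      have e : ‖Complex.exp (-2 * κ * t)‖ ≤ Real.exp (-(2 * κ * x)) := by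
        rw [show (-2 * κ * t : ℂ) = ((-(2 * κ * t) : ℝ) : ℂ) by push_cast; ring, hnexp]
        gcongr
      rw [hsplit t, mul_assoc, mul_left_comm (Complex.exp (κ * t)), norm_mul, norm_mul,
        Complex.norm_real]
      calc _ ≤ Real.exp (-(2 * κ * x)) * (‖potential lam q t‖ * M) := by gcongr
        _ = _ := by ring
    have e1 : Complex.exp (κ * x) * (deriv f x + κ * f x) =
        Complex.exp ((2 * κ * x : ℝ) : ℂ) * (Complex.exp (-κ * x) * (deriv f x - -κ * f x)) := by
      rw [← mul_assoc, ← Complex.exp_add]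
      push_cast
      ring_nf
    rw [e1, norm_mul, hnexp]
    calc _ ≤ Real.exp (2 * κ * x) *
          (M * Real.exp (-(2 * κ * x)) * ∫ x, ‖potential lam q x‖) := by gcongr
      _ = _ := by rw [Real.exp_neg]; field_simp

theorem IsSchrodingerSolution.const_mul {V : ℝ → ℝ} {z : ℂ} {y : ℝ → ℂ}
    (h : IsSchrodingerSolution V z y) (c : ℂ) : IsSchrodingerSolution V z fun x => c * y x := by
  refine ⟨contDiff_const.mul h.1, fun s t => ?_⟩
  rw [deriv_const_mul_field, deriv_const_mul_field, ← mul_sub, h.2,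
    ← intervalIntegral.integral_const_mul]
  exact intervalIntegral.integral_congr fun x _ => by ring

/-- Once `κ` exceeds twice the `L¹` norm of the potential, the unnormalised Jost solution at
`z = iκ` and its derivative are close to `1` and `-κ` at the origin. -/
theorem IsJostPlus.norm_sub_le (hq : Integrable q) {κ : ℝ} (hκ : 0 < κ)
    (hκN : 2 * ∫ x, ‖potential lam q x‖ ≤ κ) {y : ℝ → ℂ}
    (hy : IsJostPlus lam q (Complex.I * κ) y) :
    ‖Complex.Gamma (1 + κ) * y 0 - 1‖ ≤ (2 * ∫ x, ‖potential lam q x‖) / κ ∧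
    ‖Complex.Gamma (1 + κ) * deriv y 0 + κ‖ ≤ 2 * ∫ x, ‖potential lam q x‖ := by
  set N := ∫ x, ‖potential lam q x‖ with hN
  set f : ℝ → ℂ := fun x => Complex.Gamma (1 + κ) * y x with hf
  have hN0 : 0 ≤ N := integral_nonneg fun x => norm_nonneg _
  have h := hy.1.const_mul (Complex.Gamma (1 + κ))
  have hd : ∀ x, deriv f x = Complex.Gamma (1 + κ) * deriv y x := fun x => by
    rw [hf, deriv_const_mul_field]
  obtain ⟨h1, h2⟩ := hy.tendsto_exp_mul hκ
  simp only [← hd] at h2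
  have hκ2 : ‖(2 * κ : ℂ)‖ = 2 * κ := by simp [abs_of_pos hκ]
  have hκ0 : (κ : ℂ) ≠ 0 := by exact_mod_cast hκ.ne'
  have step : ∀ M : ℝ, (∀ x : ℝ, 0 ≤ x → ‖Complex.exp (κ * x) * f x‖ ≤ M) →
      ∀ x : ℝ, 0 ≤ x → ‖Complex.exp (κ * x) * f x - 1‖ ≤ M * N / κ := by
    intro M hM x hx
    obtain ⟨hR, hP⟩ := norm_exp_mul_sub_le hq hκ h h1 h2 hM hx
    have e : Complex.exp (κ * x) * f x - 1 = (Complex.exp (κ * x) * (deriv f x + κ * f x) -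
        (Complex.exp (κ * x) * (deriv f x - κ * f x) + 2 * κ)) / (2 * κ) := by
      field_simp; ring
    rw [e, norm_div, hκ2, div_le_div_iff₀ (by positivity) hκ]
    have := _root_.norm_sub_le (Complex.exp ((κ : ℂ) * (x : ℂ)) * (deriv f x + (κ : ℂ) * f x))
      (Complex.exp ((κ : ℂ) * (x : ℂ)) * (deriv f x - (κ : ℂ) * f x) + 2 * (κ : ℂ))
    nlinarith
  -- `e^{κx} f` is bounded, and its supremum `M` satisfies `M ≤ 1 + M N / κ ≤ 1 + M / 2`
  have hcont : Continuous fun x : ℝ => Complex.exp (κ * x) * f x :=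
    (by fun_prop : Continuous fun x : ℝ => Complex.exp (κ * x)).mul h.1.continuous
  have hbdd : BddAbove ((fun x : ℝ => ‖Complex.exp (κ * x) * f x‖) '' Set.Ici 0) := by
    obtain ⟨T, hT⟩ := eventually_atTop.1 (h1.norm.eventually_le_const
      (by simp : ‖(1 : ℂ)‖ < 2))
    obtain ⟨B, hB⟩ := isCompact_Icc (a := (0 : ℝ)) (b := T) |>.exists_bound_of_continuousOn
      hcont.continuousOn
    refine ⟨max B 2, ?_⟩
    rintro _ ⟨x, hx, rfl⟩
    rcases le_total x T with hxT | hxT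
    · exact (hB x ⟨hx, hxT⟩).trans (le_max_left _ _)
    · exact (hT x hxT).trans (le_max_right _ _)
  set M := sSup ((fun x : ℝ => ‖Complex.exp (κ * x) * f x‖) '' Set.Ici 0) with hMdef
  have hM : ∀ x : ℝ, 0 ≤ x → ‖Complex.exp (κ * x) * f x‖ ≤ M := fun x hx =>
    le_csSup hbdd ⟨x, hx, rfl⟩
  have hM2 : M ≤ 2 := by
    have : M ≤ 1 + M * N / κ := by
      refine csSup_le (Set.nonempty_Ici.image _) ?_
      rintro _ ⟨x, hx, rfl⟩
      have h3 := step M hM x hx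
      have h4 := norm_add_le (Complex.exp (κ * x) * f x - 1) 1
      rw [sub_add_cancel, norm_one] at h4
      linarith
    have hM0 : 0 ≤ M := (norm_nonneg _).trans (hM 0 le_rfl)
    have : M * N / κ ≤ M / 2 := by
      rw [div_le_div_iff₀ hκ two_pos]; nlinarith
    linarith
  have hM' : ∀ x : ℝ, 0 ≤ x → ‖Complex.exp (κ * x) * f x‖ ≤ 2 := fun x hx => (hM x hx).trans hM2
  obtain ⟨hR, hP⟩ := norm_exp_mul_sub_le hq hκ h h1 h2 hM' le_rfl
  refine ⟨by simpa using step 2 hM' 0 le_rfl, ?_⟩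
  rw [← hd]
  simp only [Complex.ofReal_zero, mul_zero, Complex.exp_zero, one_mul] at hR hP
  have e : deriv f 0 + κ = ((deriv f 0 - κ * f 0 + 2 * κ) + (deriv f 0 + κ * f 0)) / 2 := by ring
  rw [e, norm_div, Complex.norm_ofNat, div_le_iff₀ two_pos]
  have := norm_add_le (deriv f 0 - κ * f 0 + 2 * κ) (deriv f 0 + κ * f 0)
  linarith

theorem tendsto_jostPlus_zero (lam : ℝ) (hq : Integrable q) (hc : HasCompactSupport q) :
    Tendsto (fun κ : ℝ => Complex.Gamma (1 + κ) * jostPlus lam q (Complex.I * κ) 0) atTop (𝓝 1) ∧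
    Tendsto (fun κ : ℝ => Complex.Gamma (1 + κ) * deriv (jostPlus lam q (Complex.I * κ)) 0 / κ)
      atTop (𝓝 (-1)) := by
  set N := ∫ x, ‖potential lam q x‖ with hN
  have hev : ∀ᶠ κ : ℝ in atTop, 0 < κ ∧ 2 * N ≤ κ :=
    (eventually_gt_atTop 0).and (eventually_ge_atTop _)
  have h0 : Tendsto (fun κ : ℝ => (2 * N) / κ) atTop (𝓝 0) :=
    tendsto_const_nhds.div_atTop tendsto_id
  constructor <;> rw [tendsto_iff_norm_sub_tendsto_zero]
  · refine squeeze_zero' (.of_forall fun _ => norm_nonneg _) ?_ h0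
    filter_upwards [hev] with κ hκ
    exact ((isJostPlus_jostPlus hq hc _).norm_sub_le hq hκ.1 hκ.2).1
  · refine squeeze_zero' (.of_forall fun _ => norm_nonneg _) ?_ h0
    filter_upwards [hev] with κ hκ
    have := ((isJostPlus_jostPlus hq hc _).norm_sub_le hq hκ.1 hκ.2).2
    have hκ0 : (κ : ℂ) ≠ 0 := by exact_mod_cast hκ.1.ne'
    have hκn : ‖(κ : ℂ)‖ = κ := by simp [abs_of_pos hκ.1]
    rw [sub_neg_eq_add, div_add_one hκ0, norm_div, hκn]
    exact div_le_div_of_nonneg_right this hκ.1.le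

/-- High-energy asymptotics on the positive imaginary axis: `W(iκ) ~ -2κ / Γ(1 + κ)²`. -/
theorem tendsto_jostW (lam : ℝ) (hq : Integrable q) (hc : HasCompactSupport q) :
    Tendsto (fun κ : ℝ => Complex.Gamma (1 + κ) ^ 2 * jostW lam q (Complex.I * κ) / (-2 * κ)) atTop
      (𝓝 1) := by
  obtain ⟨hp, hp'⟩ := tendsto_jostPlus_zero lam hq hc
  obtain ⟨hm, hm'⟩ := tendsto_jostPlus_zero lam hq.comp_neg (hasCompactSupport_comp_neg hc)
  have h := ((hm.mul hp').add (hm'.mul hp)).div_const (-2)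
  refine (h.congr fun κ => ?_).trans_eq (by norm_num)
  simp only [jostW, wronskian, jostMinus_eq hq hc, deriv_comp_neg_eq, neg_zero]
  rcases eq_or_ne (κ : ℂ) 0 with h0 | h0
  · simp [h0]
  · field_simp
    ring

end

/-! ### Entire functions of order at most one with the same zeros -/

/-- Two entire functions with the same zeros, counted with multiplicity, differ by an entire
factor without zeros. -/
theorem exists_eq_mul_of_analyticOrderAt_eq {u v : ℂ → ℂ} (hu : Differentiable ℂ u)
    (hv : Differentiable ℂ v) (hv0 : ∃ z, v z ≠ 0)
    (h : ∀ z, analyticOrderAt u z = analyticOrderAt v z) :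
    ∃ G : ℂ → ℂ, Differentiable ℂ G ∧ (∀ z, G z ≠ 0) ∧ ∀ z, u z = G z * v z := by
  have hua : ∀ z, AnalyticAt ℂ u z := fun z => hu.analyticAt z
  have hva : ∀ z, AnalyticAt ℂ v z := fun z => hv.analyticAt z
  obtain ⟨z₀, hz₀⟩ := hv0
  have htop : ∀ z, analyticOrderAt v z ≠ ⊤ := fun z =>
    AnalyticOnNhd.analyticOrderAt_ne_top_of_isPreconnected (x := z₀) (U := Set.univ)
      (fun x _ => hva x) isPreconnected_univ trivial trivial
      (by rw [(hva z₀).analyticOrderAt_eq_zero.2 hz₀]; simp)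
  have hm : MeromorphicOn (u / v) Set.univ := fun z _ =>
    (hua z).meromorphicAt.div (hva z).meromorphicAt
  have hord : ∀ z, meromorphicOrderAt (u / v) z = 0 := by
    intro z
    rw [div_eq_mul_inv, meromorphicOrderAt_mul (hua z).meromorphicAt (hva z).meromorphicAt.inv,
      meromorphicOrderAt_inv, (hua z).meromorphicOrderAt_eq, (hva z).meromorphicOrderAt_eq, h z]
    obtain ⟨n, hn⟩ := ENat.ne_top_iff_exists.1 (htop z)
    rw [← hn]
    simp only [ENat.map_natCast]
    exact LinearOrderedAddCommGroupWithTop.add_neg_cancel_of_ne_top (by simp)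
  set G := toMeromorphicNFOn (u / v) Set.univ with hG
  have hNF : ∀ z, MeromorphicNFAt G z := fun z =>
    meromorphicNFOn_toMeromorphicNFOn (u / v) Set.univ (Set.mem_univ z)
  have hGord : ∀ z, meromorphicOrderAt G z = 0 := fun z => by
    rw [hG, meromorphicOrderAt_toMeromorphicNFOn hm (Set.mem_univ z), hord]
  have hGa : ∀ z, AnalyticAt ℂ G z := fun z =>
    (hNF z).meromorphicOrderAt_nonneg_iff_analyticAt.1 (hGord z).ge
  refine ⟨G, fun z => (hGa z).differentiableAt, fun z =>
    (hNF z).meromorphicOrderAt_eq_zero_iff.1 (hGord z), fun z => ?_⟩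
  have hne : ∀ᶠ x in 𝓝[≠] z, v x ≠ 0 :=
    (hva z).eventually_eq_zero_or_eventually_ne_zero.resolve_left fun h0 =>
      htop z (analyticOrderAt_eq_top.2 h0)
  have hev : u =ᶠ[𝓝[≠] z] fun x => G x * v x := by
    filter_upwards [hm.toMeromorphicNFOn_eq_self_on_nhdsNE (Set.mem_univ z), hne] with x hx hx0
    rw [hG, hx, Pi.div_apply, div_mul_cancel₀ _ hx0]
  exact ((hu.continuous.continuousAt.eventuallyEq_nhds_iff_eventuallyEq_nhdsNE
    (((hGa z).continuousAt).mul (hva z).continuousAt)).1 hev).eq_of_nhds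

/-- An entire function without zeros is the exponential of an entire function. -/
theorem exists_differentiable_exp_eq {G : ℂ → ℂ} (hG : Differentiable ℂ G) (h0 : ∀ z, G z ≠ 0) :
    ∃ g : ℂ → ℂ, Differentiable ℂ g ∧ ∀ z, G z = Complex.exp (g z) := by
  have hd : Differentiable ℂ fun z => deriv G z / G z :=
    hG.deriv.div hG h0
  obtain ⟨p, hp⟩ := hd.isExactOn_univ
  have hp' : ∀ z, HasDerivAt p (deriv G z / G z) z := fun z => hp z trivial
  -- `G e^{-p}` is constant
  have hc : ∀ z, HasDerivAt (fun z => G z * Complex.exp (-p z)) 0 z := fun z => by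
    refine ((hG z).hasDerivAt.mul (hp' z).neg.cexp).congr_deriv ?_
    have := h0 z
    field_simp
    ring
  have hconst : ∀ z, G z * Complex.exp (-p z) = G 0 * Complex.exp (-p 0) := fun z =>
    is_const_of_deriv_eq_zero (fun z => (hc z).differentiableAt) (fun z => (hc z).deriv) z 0
  refine ⟨fun z => p z + (Complex.log (G 0) - p 0), fun z =>
    ((hp' z).differentiableAt).add_const _, fun z => ?_⟩
  rw [Complex.exp_add, Complex.exp_sub, Complex.exp_log (h0 0)]
  have := hconst z
  rw [Complex.exp_neg, Complex.exp_neg] at this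
  have h1 := Complex.exp_ne_zero (p z)
  have h2 := Complex.exp_ne_zero (p 0)
  field_simp at this ⊢
  linear_combination this

/-- The proximity function of an entire function of order at most one is `O(r^{3/2})`. -/
theorem IsEntireOfOrderAtMostOne.proximity_le {u : ℂ → ℂ} (hu : IsEntireOfOrderAtMostOne u) :
    ∃ C : ℝ, 0 ≤ C ∧ ∀ r : ℝ, 1 ≤ r →
      ValueDistribution.proximity u ⊤ r ≤ C * r ^ (3 / 2 : ℝ) := by
  obtain ⟨C, hC⟩ := hu.2 (1 / 2) (by norm_num)
  have hl : 0 ≤ Real.posLog C := Real.posLog_nonneg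
  refine ⟨Real.posLog C + 1, by positivity, fun r hr => ?_⟩
  have hr1 : (1 : ℝ) ≤ r ^ (3 / 2 : ℝ) := Real.one_le_rpow hr (by norm_num)
  rw [ValueDistribution.proximity_top]
  refine Real.circleAverage_mono_on_of_le_circle
    (MeromorphicOn.circleIntegrable_posLog_norm fun x _ => (hu.1.analyticAt x).meromorphicAt)
    fun z hz => ?_
  have hzr : ‖z‖ = r := by
    rw [mem_sphere_zero_iff_norm, abs_of_pos (by linarith)] at hz; exact hz
  calc Real.posLog ‖u z‖ ≤ Real.posLog (C * Real.exp (r ^ (3 / 2 : ℝ))) := by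
        refine Real.posLog_le_posLog (norm_nonneg _) ?_
        have := hC z
        rw [hzr] at this
        norm_num at this ⊢
        exact this
    _ ≤ Real.posLog C + Real.posLog (Real.exp (r ^ (3 / 2 : ℝ))) := Real.posLog_mul
    _ = Real.posLog C + r ^ (3 / 2 : ℝ) := by
        rw [Real.posLog_apply (x := Real.exp _), Real.log_exp, max_eq_right (by positivity)]
    _ ≤ _ := by nlinarith

/-- By Jensen's formula the proximity function of the reciprocal of an entire function is
bounded by that of the function, up to an additive constant. -/
theorem exists_proximity_inv_le {v : ℂ → ℂ} (hv : Differentiable ℂ v) :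
    ∃ C : ℝ, ∀ r : ℝ, 1 ≤ r → ValueDistribution.proximity v⁻¹ ⊤ r ≤
      ValueDistribution.proximity v ⊤ r + C := by
  have hm : Meromorphic v := fun x => (hv.analyticAt x).meromorphicAt
  refine ⟨-Real.log ‖meromorphicTrailingCoeffAt v 0‖, fun r hr => ?_⟩
  have h1 := congrFun (ValueDistribution.proximity_sub_proximity_inv_eq_circleAverage hm) r
  have h2 := Function.locallyFinsuppWithin.logCounting_divisor_eq_circleAverage_sub_const hm
    (by linarith : r ≠ 0)
  have h3 := Function.locallyFinsuppWithin.logCounting_nonneg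
    (MeromorphicOn.AnalyticOnNhd.divisor_nonneg (f := v) (U := Set.univ) fun x _ =>
      hv.analyticAt x) hr
  rw [Pi.sub_apply] at h1
  linarith

/-- An entire function `g` for which the circle averages of the positive part of `Re g` are
`O(r^{3/2})` is a polynomial of degree at most one. -/
theorem exists_eq_affine_of_circleAverage_le {g : ℂ → ℂ} (hg : Differentiable ℂ g) {C : ℝ}
    (hC : 0 ≤ C)
    (h : ∀ r : ℝ, 1 ≤ r →
      Real.circleAverage (fun z => max 0 (g z).re) 0 r ≤ C * r ^ (3 / 2 : ℝ)) :
    ∃ α β : ℂ, ∀ z, g z = α * z + β := by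
  have hcont : Continuous fun z => max 0 (g z).re :=
    continuous_const.max (Complex.continuous_re.comp hg.continuous)
  -- Poisson's formula turns the bound for the averages into a pointwise bound
  have hre : ∀ r : ℝ, 1 ≤ r → ∀ w ∈ Metric.ball (0 : ℂ) (r / 2),
      (g w).re ≤ 3 * C * r ^ (3 / 2 : ℝ) := by
    intro r hr w hw
    have hr0 : 0 < r := by linarith
    have hwn : ‖w‖ < r / 2 := mem_ball_zero_iff.1 hw
    have hwr : w ∈ Metric.ball (0 : ℂ) r := mem_ball_zero_iff.2 (by linarith)
    set K : ℂ → ℝ := fun z => ((z - 0 + (w - 0)) / ((z - 0) - (w - 0))).re with hK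
    have hKc : ContinuousOn K (Metric.sphere 0 |r|) := by
      refine Complex.continuous_re.comp_continuousOn (ContinuousOn.div (by fun_prop) (by fun_prop)
        fun z hz => ?_)
      rw [mem_sphere_zero_iff_norm, abs_of_pos hr0] at hz
      intro h0
      have : z = w := by simpa [sub_eq_zero] using h0
      rw [this] at hz
      linarith
    have hP := hg.diffContOnCl.circleAverage_re_herglotzRieszKernel_smul' hwr
    have hint : CircleIntegrable (fun z => K z • g z) 0 r :=
      (hKc.smul hg.continuous.continuousOn).circleIntegrable'
    have hP' : Real.circleAverage (fun z => K z * (g z).re) 0 r = (g w).re := by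
      rw [← hP]
      have := Complex.reCLM.circleAverage_comp_comm hint
      simpa [Function.comp_def, hK] using this
    rw [← hP']
    have hK0 : ∀ z ∈ Metric.sphere (0 : ℂ) |r|, 0 ≤ K z ∧ K z ≤ 3 := by
      intro z hz
      rw [abs_of_pos hr0] at hz
      have h1 := le_re_herglotzRieszKernel hz hwr
      have h2 := re_herglotzRieszKernel_le hz hwr
      rw [sub_zero w] at h1 h2
      simp only [hK, sub_zero w]
      refine ⟨le_trans (div_nonneg (by linarith) (by positivity)) h1, h2.trans ?_⟩
      rw [div_le_iff₀ (by linarith)]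
      linarith
    calc Real.circleAverage (fun z => K z * (g z).re) 0 r
        ≤ Real.circleAverage (fun z => 3 * max 0 (g z).re) 0 r := by
          refine Real.circleAverage_mono
            (hKc.mul (Complex.continuous_re.comp hg.continuous).continuousOn).circleIntegrable'
            (continuous_const.mul hcont).continuousOn.circleIntegrable' fun z hz => ?_
          obtain ⟨h1, h2⟩ := hK0 z hz
          have h3 : (g z).re ≤ max 0 (g z).re := le_max_right _ _
          have h4 : 0 ≤ max 0 (g z).re := le_max_left _ _
          nlinarith
      _ = 3 * Real.circleAverage (fun z => max 0 (g z).re) 0 r := by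
          have := Real.circleAverage_fun_smul (a := (3 : ℝ)) (f := fun z => max 0 (g z).re)
            (c := 0) (R := r)
          simpa using this
      _ ≤ _ := by nlinarith [h r hr]
  -- hence, by Borel–Carathéodory, a bound for `|g|`
  have hnorm : ∀ r : ℝ, 1 ≤ r → ∀ z : ℂ, ‖z‖ ≤ r / 4 →
      ‖g z‖ ≤ (6 * C + 2 + 3 * ‖g 0‖) * r ^ (3 / 2 : ℝ) := by
    intro r hr z hz
    have hr1 : (1 : ℝ) ≤ r ^ (3 / 2 : ℝ) := Real.one_le_rpow hr (by norm_num)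
    have hM : 0 < 3 * C * r ^ (3 / 2 : ℝ) + 1 := by positivity
    have hb := Complex.borelCaratheodory (z := z) hM hg.differentiableOn
      (fun w hw => (hre r hr w hw).trans (by linarith)) (by linarith : 0 < r / 2)
      (mem_ball_zero_iff.2 (by linarith))
    have hn := norm_nonneg z
    have hd : 0 < r / 2 - ‖z‖ := by linarith
    have h1 : 2 * (3 * C * r ^ (3 / 2 : ℝ) + 1) * ‖z‖ / (r / 2 - ‖z‖) ≤
        2 * (3 * C * r ^ (3 / 2 : ℝ) + 1) := by
      rw [div_le_iff₀ hd]
      exact mul_le_mul_of_nonneg_left (by linarith) (by linarith)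
    have h2 : ‖g 0‖ * (r / 2 + ‖z‖) / (r / 2 - ‖z‖) ≤ 3 * ‖g 0‖ := by
      rw [div_le_iff₀ hd]
      have := norm_nonneg (g 0)
      nlinarith
    have := norm_nonneg (g 0)
    nlinarith
  -- Cauchy's estimate for the second derivative
  have hdd : ∀ c : ℂ, iteratedDeriv 2 g c = 0 := by
    intro c
    set D := 6 * C + 2 + 3 * ‖g 0‖ with hD
    have hlim : Tendsto (fun R : ℝ => (2 : ℝ) * (D * 8 ^ (3 / 2 : ℝ)) * R ^ (-(1 / 2) : ℝ)) atTop
        (𝓝 0) := by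
      simpa using (tendsto_rpow_neg_atTop (by norm_num : (0 : ℝ) < 1 / 2)).const_mul
        (2 * (D * 8 ^ (3 / 2 : ℝ)))
    refine norm_le_zero_iff.1 (ge_of_tendsto hlim ?_)
    filter_upwards [eventually_ge_atTop 1, eventually_ge_atTop ‖c‖] with R hR hRc
    have hR0 : 0 < R := by linarith
    have := Complex.norm_iteratedDeriv_le_of_forall_mem_sphere_norm_le (c := c) (R := R)
      (C := D * (8 * R) ^ (3 / 2 : ℝ)) 2 hR0 hg.diffContOnCl fun z hz =>
        hnorm (8 * R) (by linarith) z (by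
          have h1 : ‖z - c‖ = R := mem_sphere_iff_norm.1 hz
          have h2 := norm_add_le (z - c) c
          rw [sub_add_cancel] at h2
          linarith)
    refine this.trans_eq ?_
    have e : R ^ (3 / 2 : ℝ) = R ^ (-(1 / 2) : ℝ) * R ^ 2 := by
      rw [← Real.rpow_natCast R 2, ← Real.rpow_add hR0]; norm_num
    rw [Real.mul_rpow (by norm_num) hR0.le, e]
    simp only [Nat.factorial]
    push_cast
    field_simp
  have hdd' : ∀ c, deriv (deriv g) c = 0 := fun c => by
    rw [← hdd c, iteratedDeriv_succ, iteratedDeriv_one]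
  have hconst : ∀ z, deriv g z = deriv g 0 := fun z =>
    is_const_of_deriv_eq_zero hg.deriv hdd' z 0
  refine ⟨deriv g 0, g 0, fun z => ?_⟩
  have hd0 : ∀ z, HasDerivAt (fun z => g z - deriv g 0 * z) 0 z := fun z => by
    refine ((hg z).hasDerivAt.sub ((hasDerivAt_id z).const_mul (deriv g 0))).congr_deriv ?_
    rw [hconst z]; ring
  have := is_const_of_deriv_eq_zero (fun z => (hd0 z).differentiableAt) (fun z => (hd0 z).deriv) z 0
  simp only [mul_zero, sub_zero] at this
  linear_combination this

/-- Two entire functions of order at most one with the same zeros, counted with multiplicity,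
differ by a factor `e^{αz + β}`. -/
theorem IsEntireOfOrderAtMostOne.exists_eq_exp_mul {u v : ℂ → ℂ}
    (hu : IsEntireOfOrderAtMostOne u) (hv : IsEntireOfOrderAtMostOne v) (hv0 : ∃ z, v z ≠ 0)
    (h : ∀ z, analyticOrderAt u z = analyticOrderAt v z) :
    ∃ α β : ℂ, ∀ z, u z = Complex.exp (α * z + β) * v z := by
  obtain ⟨G, hGd, hG0, hG⟩ := exists_eq_mul_of_analyticOrderAt_eq hu.1 hv.1 hv0 h
  obtain ⟨g, hgd, hg⟩ := exists_differentiable_exp_eq hGd hG0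
  obtain ⟨Cu, hCu, hu'⟩ := hu.proximity_le
  obtain ⟨Cv, hCv, hv'⟩ := hv.proximity_le
  obtain ⟨C, hC⟩ := exists_proximity_inv_le hv.1
  have hum : Meromorphic u := fun x => (hu.1.analyticAt x).meromorphicAt
  have hvm : Meromorphic v := fun x => (hv.1.analyticAt x).meromorphicAt
  have hva : AnalyticOnNhd ℂ v Set.univ := fun x _ => hv.1.analyticAt x
  have hGe : (u * v⁻¹) =ᶠ[codiscrete ℂ] G := by
    have hcod : ∀ᶠ z in codiscrete ℂ, v z ≠ 0 := by
      obtain ⟨z₀, hz₀⟩ := hv0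
      have := hva.preimage_zero_mem_codiscreteWithin (x := z₀) hz₀ trivial isConnected_univ
      filter_upwards [this] with z hz using hz
    filter_upwards [hcod] with z hz
    simp [hG z, hz]
  obtain ⟨α, β, hαβ⟩ := exists_eq_affine_of_circleAverage_le hgd
    (C := Cu + Cv + |C|) (by positivity) fun r hr => by
      have hr1 : (1 : ℝ) ≤ r ^ (3 / 2 : ℝ) := Real.one_le_rpow hr (by norm_num)
      have h1 : Real.circleAverage (fun z => max 0 (g z).re) 0 r =
          ValueDistribution.proximity G ⊤ r := by
        rw [ValueDistribution.proximity_top]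
        simp [hg, Complex.norm_exp, Real.posLog_apply]
      have h2 := ValueDistribution.proximity_mul_top_le hum hvm.inv r
      rw [h1, ← ValueDistribution.proximity_congr_codiscrete (a := ⊤) hGe (by linarith)]
      rw [Pi.add_apply] at h2
      have := hu' r hr
      have := hv' r hr
      have := hC r hr
      have := le_abs_self C
      have := abs_nonneg C
      nlinarith
  exact ⟨α, β, fun z => by rw [hG, hg, hαβ]⟩

/-! ### The Jost function is determined by its non-zero zeros -/

theorem eventually_jostW_ne_zero (lam : ℝ) {q : ℝ → ℝ} (hq : Integrable q)
    (hc : HasCompactSupport q) :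
    ∀ᶠ κ : ℝ in atTop, jostW lam q (Complex.I * κ) ≠ 0 := by
  filter_upwards [(tendsto_jostW lam hq hc).eventually_ne one_ne_zero] with κ hκ h0
  simp [h0] at hκ

/-- A function `t ↦ t^m e^{γt + δ}` with `m` an integer that tends to `1` at `+∞` has `m = 0`,
`γ = 0` and `e^δ = 1`. -/
theorem eq_zero_of_tendsto_zpow_mul_exp {m : ℤ} {γ δ : ℂ}
    (h : Tendsto (fun t : ℝ => (t : ℂ) ^ m * Complex.exp (γ * t + δ)) atTop (𝓝 1)) :
    m = 0 ∧ γ = 0 ∧ Complex.exp δ = 1 := by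
  -- shifting the argument by `s` gives `e^{γs} = 1` for all real `s`
  have hγ : γ = 0 := by
    have hs : ∀ s : ℝ, Complex.exp (γ * s) = 1 := by
      intro s
      have h1 : Tendsto (fun t : ℝ => ((t + s : ℝ) : ℂ) ^ m * Complex.exp (γ * (t + s : ℝ) + δ))
          atTop (𝓝 1) := h.comp (tendsto_atTop_add_const_right _ s tendsto_id)
      have h2 := h1.div h one_ne_zero
      have h3 : Tendsto (fun t : ℝ => (((t + s) / t : ℝ) : ℂ) ^ m * Complex.exp (γ * s)) atTop
          (𝓝 (((1 : ℝ) : ℂ) ^ m * Complex.exp (γ * s))) := by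
        refine Tendsto.mul_const _ (Tendsto.zpow₀ ?_ m (Or.inl (by simp)))
        refine (Complex.continuous_ofReal.tendsto 1).comp ?_
        have h4 : Tendsto (fun t : ℝ => 1 + s / t) atTop (𝓝 (1 + 0)) :=
          (tendsto_const_nhds.div_atTop tendsto_id).const_add 1
        rw [add_zero] at h4
        refine h4.congr' ?_
        filter_upwards [eventually_gt_atTop 0] with t ht
        field_simp
      have h5 := tendsto_nhds_unique (h3.congr' ?_) h2
      · simpa using h5
      · filter_upwards [eventually_gt_atTop 0] with t ht
        have ht' : (t : ℂ) ≠ 0 := by exact_mod_cast ht.ne'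
        have : γ * ((t + s : ℝ) : ℂ) + δ = γ * s + (γ * t + δ) := by push_cast; ring
        rw [Pi.div_apply, this, Complex.exp_add (γ * s), Complex.ofReal_div, div_zpow]
        have := Complex.exp_ne_zero (γ * t + δ)
        field_simp
    have hd : HasDerivAt (fun s : ℝ => Complex.exp (γ * s)) γ 0 := by
      refine ((Complex.ofRealCLM.hasDerivAt (x := (0 : ℝ))).const_mul γ).cexp.congr_deriv ?_
      simp
    simp only [hs] at hd
    exact hd.unique (hasDerivAt_const _ _)
  subst hγ
  -- doubling the argument gives `2^m = 1`
  have hm : m = 0 := by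
    have h1 : Tendsto (fun t : ℝ => ((2 * t : ℝ) : ℂ) ^ m * Complex.exp (0 * (2 * t : ℝ) + δ))
        atTop (𝓝 1) := h.comp (tendsto_id.const_mul_atTop two_pos)
    have h2 := h1.div h one_ne_zero
    have h3 : (2 : ℂ) ^ m = 1 := by
      refine tendsto_nhds_unique (tendsto_const_nhds.congr' ?_) (h2.trans_eq (by simp))
      filter_upwards [eventually_gt_atTop 0] with t ht
      have ht' : (t : ℂ) ≠ 0 := by exact_mod_cast ht.ne'
      have := Complex.exp_ne_zero δ
      rw [Pi.div_apply, Complex.ofReal_mul, mul_zpow]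
      simp only [zero_mul, zero_add]
      field_simp
      simp
    have h4 : (2 : ℝ) ^ m = 1 := by
      have := congrArg norm h3
      simpa using this
    exact (zpow_eq_one_iff_right₀ (by norm_num) (by norm_num)).1 h4
  subst hm
  refine ⟨rfl, rfl, ?_⟩
  simp only [zpow_zero, one_mul, zero_mul, zero_add] at h
  exact tendsto_nhds_unique tendsto_const_nhds h

/-- The normalised Jost function is determined by its non-zero zeros: after equalising the orders
at the origin by powers of `z`, two such functions differ by `z^m e^{αz + β}`, and the high-energy
asymptotics on the imaginary axis fix this factor. -/
theorem jostW_eq_of_analyticOrderAt_eq {lam₁ lam₂ : ℝ} {q₁ q₂ : ℝ → ℝ}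
    (hq₁ : Integrable q₁) (hc₁ : HasCompactSupport q₁)
    (hq₂ : Integrable q₂) (hc₂ : HasCompactSupport q₂)
    (h : ∀ z : ℂ, z ≠ 0 →
      analyticOrderAt (jostW lam₁ q₁) z = analyticOrderAt (jostW lam₂ q₂) z) :
    jostW lam₁ q₁ = jostW lam₂ q₂ := by
  set W₁ := jostW lam₁ q₁
  set W₂ := jostW lam₂ q₂
  have hE₁ : IsEntireOfOrderAtMostOne W₁ := isEntireOfOrderAtMostOne_jostW hq₁ hc₁
  have hE₂ : IsEntireOfOrderAtMostOne W₂ := isEntireOfOrderAtMostOne_jostW hq₂ hc₂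
  have hne₁ := eventually_jostW_ne_zero lam₁ hq₁ hc₁
  have hne₂ := eventually_jostW_ne_zero lam₂ hq₂ hc₂
  have hfin : ∀ W : ℂ → ℂ, Differentiable ℂ W → (∃ z, W z ≠ 0) →
      ∃ k : ℕ, analyticOrderAt W 0 = k := fun W hW ⟨z, hz⟩ => by
    obtain ⟨k, hk⟩ := ENat.ne_top_iff_exists.1
      (AnalyticOnNhd.analyticOrderAt_ne_top_of_isPreconnected (x := z) (y := 0) (U := Set.univ)
        (fun x _ => hW.analyticAt x) isPreconnected_univ trivial trivial
        (by rw [(hW.analyticAt z).analyticOrderAt_eq_zero.2 hz]; simp))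
    exact ⟨k, hk.symm⟩
  obtain ⟨k₁, hk₁⟩ := hfin W₁ hE₁.1 ⟨_, hne₁.exists.choose_spec⟩
  obtain ⟨k₂, hk₂⟩ := hfin W₂ hE₂.1 ⟨_, hne₂.exists.choose_spec⟩
  have hid : ∀ k : ℕ, IsEntireOfOrderAtMostOne fun z : ℂ => z ^ k := fun k =>
    isEntireOfOrderAtMostOne_id.pow k
  obtain ⟨κ₀, hκ₀, hκ₀'⟩ := (hne₂.and (eventually_gt_atTop 0)).exists
  have hI : ∀ κ : ℝ, 0 < κ → Complex.I * κ ≠ 0 := fun κ hκ =>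
    mul_ne_zero Complex.I_ne_zero (by exact_mod_cast hκ.ne')
  have hmulord : ∀ (k : ℕ) (W : ℂ → ℂ), Differentiable ℂ W → ∀ z : ℂ,
      analyticOrderAt (fun z => z ^ k * W z) z =
        analyticOrderAt (fun z : ℂ => z ^ k) z + analyticOrderAt W z := fun k W hW z =>
    analyticOrderAt_mul ((hid k).1.analyticAt z) (hW.analyticAt z)
  -- `z^{k₂} W₁` and `z^{k₁} W₂` have the same zeros, including the one at the origin
  obtain ⟨α, β, hαβ⟩ := ((hid k₂).mul hE₁).exists_eq_exp_mul ((hid k₁).mul hE₂)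
    ⟨Complex.I * κ₀, mul_ne_zero (pow_ne_zero _ (hI κ₀ hκ₀')) hκ₀⟩ fun z => by
      rw [hmulord k₂ W₁ hE₁.1, hmulord k₁ W₂ hE₂.1]
      rcases eq_or_ne z 0 with rfl | hz
      · have hpow : ∀ k : ℕ, analyticOrderAt (fun z : ℂ => z ^ k) 0 = k := fun k => by
          refine (AnalyticAt.analyticOrderAt_eq_natCast ((hid k).1.analyticAt 0)).2
            ⟨fun _ => 1, analyticAt_const, one_ne_zero, .of_forall fun z => by simp⟩
        rw [hpow, hpow, hk₁, hk₂, add_comm]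
      · have hpow : ∀ k : ℕ, analyticOrderAt (fun z : ℂ => z ^ k) z = 0 := fun k =>
          ((hid k).1.analyticAt z).analyticOrderAt_eq_zero.2 (pow_ne_zero k hz)
        rw [hpow, hpow, h z hz]
  have hlim : Tendsto (fun κ : ℝ => W₁ (Complex.I * κ) / W₂ (Complex.I * κ)) atTop (𝓝 1) := by
    have := (tendsto_jostW lam₁ hq₁ hc₁).div (tendsto_jostW lam₂ hq₂ hc₂) one_ne_zero
    rw [div_one] at this
    refine this.congr' ?_
    filter_upwards [hne₂, eventually_gt_atTop 0] with κ hκ hκ0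
    have h1 : (κ : ℂ) ≠ 0 := by exact_mod_cast hκ0.ne'
    have h2 : Complex.Gamma (1 + κ) ≠ 0 := by
      refine Complex.Gamma_ne_zero_of_re_pos ?_
      simp; linarith
    rw [Pi.div_apply, div_div_div_cancel_right₀ (by simpa using h1),
      mul_div_mul_left _ _ (pow_ne_zero 2 h2)]
  have hW : ∀ z : ℂ, z ≠ 0 → W₁ z = z ^ ((k₁ : ℤ) - k₂) * Complex.exp (α * z + β) * W₂ z := by
    intro z hz
    have := hαβ z
    rw [zpow_sub₀ hz, zpow_natCast, zpow_natCast]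
    have h0 := pow_ne_zero k₂ hz
    field_simp
    linear_combination this
  -- on the imaginary axis the factor `z^m e^{αz + β}` takes the form `κ^m e^{iακ + γ + β}`
  obtain ⟨γ, hγ⟩ : ∃ γ : ℂ, Complex.exp γ = Complex.I ^ ((k₁ : ℤ) - k₂) :=
    ⟨_, Complex.exp_log (zpow_ne_zero _ Complex.I_ne_zero)⟩
  obtain ⟨hm, hα, hβ⟩ := eq_zero_of_tendsto_zpow_mul_exp (m := (k₁ : ℤ) - k₂)
    (γ := α * Complex.I) (δ := γ + β) (hlim.congr' (by
      filter_upwards [hne₂, eventually_gt_atTop 0] with κ hκ hκ0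
      rw [hW _ (hI κ hκ0), mul_div_cancel_right₀ _ hκ, mul_zpow, ← hγ,
        show α * Complex.I * κ + (γ + β) = γ + (α * (Complex.I * κ) + β) by ring,
        Complex.exp_add γ]
      ring))
  have hα0 : α = 0 := (mul_eq_zero.1 hα).resolve_right Complex.I_ne_zero
  have hβ1 : Complex.exp β = 1 := by
    rwa [Complex.exp_add, hγ, hm, zpow_zero, one_mul] at hβ
  have hWne : ∀ z : ℂ, z ≠ 0 → W₁ z = W₂ z := fun z hz => by
    rw [hW z hz, hm, hα0, zero_mul, zero_add, hβ1]; simp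
  funext z
  refine congrFun (Continuous.ext_on (dense_compl_singleton (0 : ℂ)) hE₁.1.continuous
    hE₂.1.continuous fun z hz => hWne z hz) z

end PoschlTeller

theorem mainTheorem4 :
    (∀ (lam : ℝ) (q : ℝ → ℝ), Integrable q volume → HasCompactSupport q →
      -- the normalised Jost solutions are well defined, for every complex `z`
      (∀ z : ℂ, (∃! y : ℝ → ℂ, PoschlTeller.IsJostPlus lam q z y) ∧
        (∃! y : ℝ → ℂ, PoschlTeller.IsJostMinus lam q z y)) ∧
      -- the Wronskian that defines `W` does not depend on the point
      (∀ (z : ℂ) (x : ℝ),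
        PoschlTeller.wronskian (PoschlTeller.jostMinus lam q z)
          (PoschlTeller.jostPlus lam q z) x = PoschlTeller.jostW lam q z) ∧
      -- `W` is entire of order at most one
      PoschlTeller.IsEntireOfOrderAtMostOne (PoschlTeller.jostW lam q) ∧
      -- outside `iℤ` the zeros of `W` are the poles of the reflection coefficients,
      -- with the same multiplicities
      (∀ z : ℂ, (∀ k : ℤ, z ≠ Complex.I * (k : ℂ)) → ∀ n : ℕ, 0 < n →
        (analyticOrderAt (PoschlTeller.jostW lam q) z = (n : ℕ∞) ↔
          meromorphicOrderAt (PoschlTeller.reflectionPlus lam q) z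
            = ((-(n : ℤ) : ℤ) : WithTop ℤ)) ∧
        (analyticOrderAt (PoschlTeller.jostW lam q) z = (n : ℕ∞) ↔
          meromorphicOrderAt (PoschlTeller.reflectionMinus lam q) z
            = ((-(n : ℤ) : ℤ) : WithTop ℤ)))) ∧
    -- `W` is determined by its non-vanishing zeros, listed with multiplicity
    (∀ (lam₁ lam₂ : ℝ) (q₁ q₂ : ℝ → ℝ),
      Integrable q₁ volume → HasCompactSupport q₁ →
      Integrable q₂ volume → HasCompactSupport q₂ →
      (∀ z : ℂ, z ≠ 0 →
        analyticOrderAt (PoschlTeller.jostW lam₁ q₁) z =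
          analyticOrderAt (PoschlTeller.jostW lam₂ q₂) z) →
      PoschlTeller.jostW lam₁ q₁ = PoschlTeller.jostW lam₂ q₂) := by
  refine ⟨fun lam q hq hc => ⟨fun z => ⟨⟨_, PoschlTeller.isJostPlus_jostPlus hq hc z,
      fun y hy => hy.unique hq (PoschlTeller.isJostPlus_jostPlus hq hc z)⟩,
      ⟨_, PoschlTeller.isJostMinus_jostMinus hq hc z,
      fun y hy => hy.unique hq (PoschlTeller.isJostMinus_jostMinus hq hc z)⟩⟩,
    PoschlTeller.wronskian_jostMinus_jostPlus hq hc,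
    PoschlTeller.isEntireOfOrderAtMostOne_jostW hq hc, fun z hz n hn => ?_⟩,
    fun lam₁ lam₂ q₁ q₂ hq₁ hc₁ hq₂ hc₂ h =>
      PoschlTeller.jostW_eq_of_analyticOrderAt_eq hq₁ hc₁ hq₂ hc₂ h⟩
  have hW := (PoschlTeller.isEntireOfOrderAtMostOne_jostW (lam := lam) hq hc).1.analyticAt z
  exact ⟨PoschlTeller.analyticOrderAt_eq_iff_meromorphicOrderAt_div_eq
      ((PoschlTeller.differentiable_jostSPlus hq hc).analyticAt z) hW
      (PoschlTeller.jostSPlus_ne_zero hq hc hz) hn,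
    PoschlTeller.analyticOrderAt_eq_iff_meromorphicOrderAt_div_eq
      ((PoschlTeller.differentiable_jostSMinus hq hc).analyticAt z) hW
      (PoschlTeller.jostSMinus_ne_zero hq hc hz) hn⟩
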